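/- Let $\tau(n)$ denote the number of positive divisors of $n$, let $\gamma$ be the Euler–Mascheroni constant, and let $\gamma_1 = \lim_{N\to\infty}\bigl(\sum_{k\le N}\frac{\log k}{k}-\frac{1}{2}\log^2 N\bigr)$ be the first Stieltjes constant ($\gamma_1\approx -0.0728$). For all real numbers $x\ge 1$, define $$\Delta(x) := \sum_{n\le x}\tau(n) - x(\log x + 2\gamma - 1)$$ and $$\delta(x) := \sum_{n\le x}\frac{\tau(n)}{n} - \Bigl(\tfrac{1}{2}\log^2 x + 2\gamma\log x + \gamma^2 - 2\gamma_1\Bigr).$$ Then, for all $x\ge 1$, $\Delta(x) - x\,\delta(x) = \frac{1}{4} + r(x)$, where $$|r(x)| \le \frac{1}{8} + \frac{0.316}{\sqrt{x}} + \frac{1}{64x}\quad\text{for all } x\ge 1,$$ and $$|r(x)| \le \frac{\log x}{x^{1/4}} + \frac{0.236}{\sqrt{x}} + \frac{1}{64x}\quad\text{for all } x\ge 300.$$ -/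

import Mathlib

namespace DivisorProblem

open Filter Topology

/-- The sequence `∑_{k ≤ n} (log k) / k - (log n)² / 2`. -/
noncomputable def stieltjesOneSeq (n : ℕ) : ℝ :=
  ∑ k ∈ Finset.Icc 1 n, Real.log (k : ℝ) / (k : ℝ) - (Real.log (n : ℝ)) ^ 2 / 2

/-- The first Stieltjes constant `γ₁ = lim (∑_{k ≤ n} (log k) / k - (log n)² / 2)`
(approximately `-0.0728`); the limit exists by `tendsto_stieltjesOneSeq` below. -/
noncomputable def stieltjesOne : ℝ := limUnder atTop stieltjesOneSeq

lemma log_sq_step (n : ℕ) (hn : 3 ≤ n) :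
    Real.log ((n + 1 : ℕ) : ℝ) / ((n + 1 : ℕ) : ℝ)
        ≤ (Real.log ((n + 1 : ℕ) : ℝ)) ^ 2 / 2 - (Real.log (n : ℝ)) ^ 2 / 2 ∧
      (Real.log ((n + 1 : ℕ) : ℝ)) ^ 2 / 2 - (Real.log (n : ℝ)) ^ 2 / 2
        ≤ Real.log (n : ℝ) / (n : ℝ) := by
  have h3 : (3 : ℝ) ≤ n := by exact_mod_cast hn
  have he : Real.exp 1 < 3 := Real.exp_one_lt_three
  have hd : ∀ x : ℝ, (n : ℝ) ≤ x →
      HasDerivAt (fun y => (Real.log y) ^ 2 / 2) (Real.log x / x) x := by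
    intro x hx
    have hx0 : x ≠ 0 := by linarith
    have h := ((Real.hasDerivAt_log hx0).pow 2).div_const 2
    refine h.congr_deriv ?_
    field_simp
    norm_num
  obtain ⟨c, hc, hcs⟩ := exists_hasDerivAt_eq_slope (fun y => (Real.log y) ^ 2 / 2)
    (fun x => Real.log x / x) (lt_add_one (n : ℝ))
    (fun x hx => (hd x hx.1).continuousAt.continuousWithinAt) (fun x hx => hd x hx.1.le)
  have hs : Real.log c / c
      = (Real.log ((n : ℝ) + 1)) ^ 2 / 2 - (Real.log (n : ℝ)) ^ 2 / 2 := by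
    rw [hcs]; simp
  push_cast
  rw [← hs]
  constructor
  · exact Real.log_div_self_antitoneOn (show Real.exp 1 ≤ c by linarith [hc.1])
      (show Real.exp 1 ≤ (n : ℝ) + 1 by linarith) hc.2.le
  · exact Real.log_div_self_antitoneOn (show Real.exp 1 ≤ (n : ℝ) by linarith)
      (show Real.exp 1 ≤ c by linarith [hc.1]) hc.1.le

theorem tendsto_stieltjesOneSeq : Tendsto stieltjesOneSeq atTop (𝓝 stieltjesOne) := by
  have hsucc : ∀ n, stieltjesOneSeq (n + 1) - stieltjesOneSeq n
      = Real.log ((n + 1 : ℕ) : ℝ) / ((n + 1 : ℕ) : ℝ)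
        - ((Real.log ((n + 1 : ℕ) : ℝ)) ^ 2 / 2 - (Real.log (n : ℝ)) ^ 2 / 2) := by
    intro n
    unfold stieltjesOneSeq
    rw [Finset.sum_Icc_succ_top (by omega)]
    ring
  have hanti : Antitone (fun n => stieltjesOneSeq (n + 3)) := by
    refine antitone_nat_of_succ_le fun n => ?_
    have h1 := hsucc (n + 3)
    have h2 := (log_sq_step (n + 3) (by omega)).1
    rw [show n + 1 + 3 = n + 3 + 1 by ring]
    linarith
  have hmono : Monotone (fun n : ℕ =>
      stieltjesOneSeq (n + 3) - Real.log ((n + 3 : ℕ) : ℝ) / ((n + 3 : ℕ) : ℝ)) := by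
    refine monotone_nat_of_le_succ fun n => ?_
    have h1 := hsucc (n + 3)
    have h2 := (log_sq_step (n + 3) (by omega)).2
    rw [show n + 1 + 3 = n + 3 + 1 by ring]
    linarith
  have hbdd : BddBelow (Set.range fun n => stieltjesOneSeq (n + 3)) := by
    refine ⟨stieltjesOneSeq (0 + 3) - Real.log ((0 + 3 : ℕ) : ℝ) / ((0 + 3 : ℕ) : ℝ), ?_⟩
    rintro _ ⟨n, rfl⟩
    have h1 := hmono (Nat.zero_le n)
    have h2 : 0 ≤ Real.log ((n + 3 : ℕ) : ℝ) / ((n + 3 : ℕ) : ℝ) :=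
      div_nonneg (Real.log_natCast_nonneg _) (Nat.cast_nonneg _)
    dsimp only at h1 ⊢
    linarith
  have h := tendsto_atTop_ciInf hanti hbdd
  exact tendsto_nhds_limUnder ⟨_, (tendsto_add_atTop_iff_nat 3).1 h⟩

/-- `Δ(x) = ∑_{n ≤ x} τ(n) - x (log x + 2γ - 1)`, where `τ(n)` is the number of divisors. -/
noncomputable def Delta (x : ℝ) : ℝ :=
  ∑ n ∈ Finset.Icc 1 ⌊x⌋₊, (n.divisors.card : ℝ)
    - x * (Real.log x + 2 * Real.eulerMascheroniConstant - 1)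

/-- `δ(x) = ∑_{n ≤ x} τ(n) / n - ((log x)² / 2 + 2γ log x + γ² - 2γ₁)`. -/
noncomputable def delta (x : ℝ) : ℝ :=
  ∑ n ∈ Finset.Icc 1 ⌊x⌋₊, (n.divisors.card : ℝ) / (n : ℝ)
    - ((1 / 2) * (Real.log x) ^ 2 + 2 * Real.eulerMascheroniConstant * Real.log x
        + Real.eulerMascheroniConstant ^ 2 - 2 * stieltjesOne)

end DivisorProblem

namespace DivisorProblem

open Filter Topology

/-! ### The hyperbola method -/

lemma sum_hyperbola (w : ℕ → ℝ) (M : ℕ) :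
    ∑ p ∈ (Finset.Ioc 0 M ×ˢ Finset.Ioc 0 M).filter (fun p => p.1 * p.2 ≤ M), w p.1 * w p.2
      = 2 * ∑ a ∈ Finset.Icc 1 (Nat.sqrt M), w a * ∑ b ∈ Finset.Icc 1 (M / a), w b
        - (∑ a ∈ Finset.Icc 1 (Nat.sqrt M), w a) ^ 2 := by
  set N := Nat.sqrt M with hN
  set T := (Finset.Ioc 0 M ×ˢ Finset.Ioc 0 M).filter (fun p => p.1 * p.2 ≤ M) with hT
  set A := T.filter (fun p => p.1 ≤ N) with hA
  set B := T.filter (fun p => p.2 ≤ N) with hB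
  have hmem : ∀ p : ℕ × ℕ, p ∈ T ↔ 1 ≤ p.1 ∧ 1 ≤ p.2 ∧ p.1 * p.2 ≤ M := by
    rintro ⟨a, b⟩
    simp only [hT, Finset.mem_filter, Finset.mem_product, Finset.mem_Ioc]
    constructor
    · rintro ⟨⟨⟨h1, h2⟩, h3, h4⟩, h5⟩
      exact ⟨h1, h3, h5⟩
    · rintro ⟨h1, h2, h3⟩
      exact ⟨⟨⟨h1, by nlinarith⟩, h2, by nlinarith⟩, h3⟩
  have hU : A ∪ B = T := by
    ext p
    simp only [hA, hB, Finset.mem_union, Finset.mem_filter]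
    constructor
    · rintro (h | h) <;> exact h.1
    · intro h
      by_contra hc
      have h1 : N + 1 ≤ p.1 := by by_contra h'; exact hc (Or.inl ⟨h, by omega⟩)
      have h2 : N + 1 ≤ p.2 := by by_contra h'; exact hc (Or.inr ⟨h, by omega⟩)
      have h3 := ((hmem p).1 h).2.2
      have h4 : M < (N + 1) * (N + 1) := Nat.lt_succ_sqrt M
      nlinarith [Nat.mul_le_mul h1 h2]
  have hI : A ∩ B = Finset.Icc 1 N ×ˢ Finset.Icc 1 N := by
    ext p
    simp only [hA, hB, Finset.mem_inter, Finset.mem_filter, Finset.mem_product, Finset.mem_Icc,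
      hmem]
    constructor
    · rintro ⟨⟨h1, h2⟩, h3, h4⟩
      exact ⟨⟨h1.1, h2⟩, h1.2.1, h4⟩
    · rintro ⟨⟨h1, h2⟩, h3, h4⟩
      have h5 : N * N ≤ M := Nat.sqrt_le M
      have h6 := Nat.mul_le_mul h2 h4
      exact ⟨⟨⟨h1, h3, by omega⟩, h2⟩, ⟨h1, h3, by omega⟩, h4⟩
  have hsA : ∑ p ∈ A, w p.1 * w p.2
      = ∑ a ∈ Finset.Icc 1 N, w a * ∑ b ∈ Finset.Icc 1 (M / a), w b := by
    simp_rw [Finset.mul_sum]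
    rw [Finset.sum_sigma']
    refine Finset.sum_bij' (fun p _ => ⟨p.1, p.2⟩) (fun p _ => (p.1, p.2)) ?_ ?_ ?_ ?_ ?_
    · intro p hp
      obtain ⟨h1, h2⟩ := Finset.mem_filter.1 hp
      obtain ⟨h3, h4, h5⟩ := (hmem p).1 h1
      simp only [Finset.mem_sigma, Finset.mem_Icc]
      refine ⟨⟨h3, h2⟩, h4, ?_⟩
      rw [Nat.le_div_iff_mul_le h3, mul_comm]
      exact h5
    · rintro ⟨a, b⟩ hp
      simp only [Finset.mem_sigma, Finset.mem_Icc] at hp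
      refine Finset.mem_filter.2 ⟨(hmem _).2 ⟨hp.1.1, hp.2.1, ?_⟩, hp.1.2⟩
      have := hp.2.2
      rw [Nat.le_div_iff_mul_le hp.1.1, mul_comm] at this
      exact this
    · intros; rfl
    · intros; rfl
    · intros; rfl
  have hsB : ∑ p ∈ B, w p.1 * w p.2 = ∑ p ∈ A, w p.1 * w p.2 := by
    refine Finset.sum_bij' (fun p _ => p.swap) (fun p _ => p.swap) ?_ ?_ ?_ ?_ ?_
    · intro p hp
      obtain ⟨h1, h2⟩ := Finset.mem_filter.1 hp
      obtain ⟨h3, h4, h5⟩ := (hmem p).1 h1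
      exact Finset.mem_filter.2 ⟨(hmem _).2 ⟨h4, h3, by simpa [mul_comm] using h5⟩, h2⟩
    · intro p hp
      obtain ⟨h1, h2⟩ := Finset.mem_filter.1 hp
      obtain ⟨h3, h4, h5⟩ := (hmem p).1 h1
      exact Finset.mem_filter.2 ⟨(hmem _).2 ⟨h4, h3, by simpa [mul_comm] using h5⟩, h2⟩
    · intros; simp
    · intros; simp
    · intros; simp [mul_comm]
  have hsI : ∑ p ∈ A ∩ B, w p.1 * w p.2 = (∑ a ∈ Finset.Icc 1 N, w a) ^ 2 := by
    rw [hI, Finset.sum_product, sq, Finset.sum_mul_sum]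
  have h := Finset.sum_union_inter (s₁ := A) (s₂ := B) (f := fun p : ℕ × ℕ => w p.1 * w p.2)
  rw [hU, hsI, hsB, hsA] at h
  linarith

lemma sum_card_divisors_mul (w : ℕ → ℝ) (hw : ∀ a b, w (a * b) = w a * w b) (M : ℕ) :
    ∑ n ∈ Finset.Icc 1 M, (n.divisors.card : ℝ) * w n
      = 2 * ∑ a ∈ Finset.Icc 1 (Nat.sqrt M), w a * ∑ b ∈ Finset.Icc 1 (M / a), w b
        - (∑ a ∈ Finset.Icc 1 (Nat.sqrt M), w a) ^ 2 := by
  rw [← sum_hyperbola, Finset.sum_filter]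
  have h1 : ∀ n ∈ Finset.Icc 1 M, (n.divisors.card : ℝ) * w n
      = ∑ p ∈ Finset.Ioc 0 M ×ˢ Finset.Ioc 0 M, if p.1 * p.2 = n then w p.1 * w p.2 else 0 := by
    intro n hn
    rw [Finset.mem_Icc] at hn
    rw [← Finset.sum_filter, ← Nat.divisorsAntidiagonal_eq_prod_filter_of_le (by omega) hn.2,
      ← Nat.map_div_right_divisors, Finset.sum_map, ← nsmul_eq_mul, ← Finset.sum_const]
    refine Finset.sum_congr rfl fun d hd => ?_
    change w n = w d * w (n / d)
    rw [← hw, Nat.mul_div_cancel' (Nat.dvd_of_mem_divisors hd)]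
  rw [Finset.sum_congr rfl h1, Finset.sum_comm]
  refine Finset.sum_congr rfl fun p hp => ?_
  simp only [Finset.mem_product, Finset.mem_Ioc] at hp
  rw [Finset.sum_ite_eq]
  have : 1 ≤ p.1 * p.2 := Nat.mul_pos hp.1.1 hp.2.1
  simp [Finset.mem_Icc, this]

/-! ### Euler–Maclaurin summation -/

lemma abs_le_of_local_increments {Φ b : ℝ → ℝ} {y : ℝ} (hy : 1 ≤ y)
    (h : ∀ n : ℕ, ∀ s t : ℝ, y ≤ s → s ≤ t → (n : ℝ) ≤ s → t ≤ n + 1 →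
      |Φ t - Φ s| ≤ b t - b s)
    (hΦ : Tendsto (fun n : ℕ => Φ n) atTop (𝓝 0)) (hb : Tendsto (fun n : ℕ => b n) atTop (𝓝 0)) :
    |Φ y| ≤ -b y := by
  have key : ∀ N : ℕ, ∀ t : ℝ, y ≤ t → t ≤ N → |Φ t - Φ y| ≤ b t - b y := by
    intro N
    induction N with
    | zero => intro t h1 h2; simp at h2; linarith
    | succ N ih =>
      intro t h1 h2
      push_cast at h2
      rcases le_total t N with h3 | h3
      · exact ih t h1 h3
      · rcases le_total y N with h4 | h4
        · have h5 := ih N h4 le_rfl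
          have h6 := h N N t h4 h3 le_rfl h2
          have := abs_sub_le (Φ t) (Φ N) (Φ y)
          linarith
        · exact h N y t le_rfl h1 h4 h2
  have h1 : Tendsto (fun n : ℕ => |Φ n - Φ y|) atTop (𝓝 |0 - Φ y|) :=
    (hΦ.sub tendsto_const_nhds).abs
  have h2 : Tendsto (fun n : ℕ => b n - b y) atTop (𝓝 (0 - b y)) := hb.sub tendsto_const_nhds
  have h3 := le_of_tendsto_of_tendsto h1 h2 (by
    filter_upwards [eventually_ge_atTop ⌈y⌉₊] with n hn
    exact key n n ((Nat.le_ceil y).trans (by exact_mod_cast hn)) le_rfl)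
  simpa using h3

/-- Half the periodic second Bernoulli polynomial. -/
noncomputable def halfB2 (s : ℝ) : ℝ := (Int.fract s ^ 2 - Int.fract s + 1 / 6) / 2

/-- A sixth of the periodic third Bernoulli polynomial. -/
noncomputable def sixthB3 (s : ℝ) : ℝ :=
  Int.fract s * (Int.fract s - 1 / 2) * (Int.fract s - 1) / 6

lemma abs_cubic_le {u : ℝ} (h0 : 0 ≤ u) (h1 : u ≤ 1) :
    |u * (u - 1 / 2) * (u - 1) / 6| ≤ 1 / 120 := by
  rw [abs_le]
  constructor
  · nlinarith [mul_nonneg h0 (sq_nonneg (u - 4 / 5)), mul_nonneg h0 (sub_nonneg.2 h1),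
      mul_nonneg (sub_nonneg.2 h1) (sq_nonneg (u - 4 / 5)), sq_nonneg (u - 4 / 5)]
  · nlinarith [mul_nonneg h0 (sq_nonneg (u - 1 / 5)), mul_nonneg h0 (sub_nonneg.2 h1),
      mul_nonneg (sub_nonneg.2 h1) (sq_nonneg (u - 1 / 5)), sq_nonneg (u - 1 / 5)]

lemma abs_sixthB3_le (s : ℝ) : |sixthB3 s| ≤ 1 / 120 :=
  abs_cubic_le (Int.fract_nonneg s) (Int.fract_lt_one s).le

lemma abs_halfB2_le (s : ℝ) : |halfB2 s| ≤ 1 / 12 := by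
  have h0 := Int.fract_nonneg s
  have h1 := (Int.fract_lt_one s).le
  unfold halfB2
  rw [abs_le]
  constructor <;> nlinarith [sq_nonneg (Int.fract s - 1 / 2)]

/-- Third order Euler–Maclaurin summation with an explicit bound for the tail. -/
theorem abs_eulerMaclaurin_le {F f f₁ f₂ f₃ b b' : ℝ → ℝ} {C y : ℝ} (hy : 1 ≤ y)
    (hF : ∀ t, 0 < t → HasDerivAt F (f t) t) (hf : ∀ t, 0 < t → HasDerivAt f (f₁ t) t)
    (hf₁ : ∀ t, 0 < t → HasDerivAt f₁ (f₂ t) t) (hf₂ : ∀ t, 0 < t → HasDerivAt f₂ (f₃ t) t)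
    (hb : ∀ t, 0 < t → HasDerivAt b (b' t) t) (hb' : ∀ t, y ≤ t → |f₃ t| / 120 ≤ b' t)
    (hlim : Tendsto (fun n : ℕ => ∑ k ∈ Finset.Icc 1 n, f k - F n) atTop (𝓝 C))
    (hf0 : Tendsto f atTop (𝓝 0)) (hf₁0 : Tendsto f₁ atTop (𝓝 0)) (hb0 : Tendsto b atTop (𝓝 0)) :
    |∑ k ∈ Finset.Icc 1 ⌊y⌋₊, f k - F y - C + (Int.fract y - 1 / 2) * f y
      - halfB2 y * f₁ y + sixthB3 y * f₂ y| ≤ -b y := by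
  set Φ : ℝ → ℝ := fun s => ∑ k ∈ Finset.Icc 1 ⌊s⌋₊, f k - F s - C
    + (Int.fract s - 1 / 2) * f s - halfB2 s * f₁ s + sixthB3 s * f₂ s with hΦ
  set G : ℕ → ℝ → ℝ := fun n s => ∑ k ∈ Finset.Icc 1 n, f k - F s - C
    + (s - n - 1 / 2) * f s - ((s - n) ^ 2 - (s - n) + 1 / 6) / 2 * f₁ s
    + (s - n) * (s - n - 1 / 2) * (s - n - 1) / 6 * f₂ s with hG
  have hΦn : ∀ n : ℕ, Φ n = ∑ k ∈ Finset.Icc 1 n, f k - F n - C - 1 / 2 * f n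
      - 1 / 12 * f₁ n := by
    intro n
    simp only [hΦ, halfB2, sixthB3, Nat.floor_natCast, Int.fract_natCast]
    ring
  have hΦG : ∀ n : ℕ, ∀ s : ℝ, (n : ℝ) ≤ s → s ≤ n + 1 → Φ s = G n s := by
    intro n s h1 h2
    rcases h2.lt_or_eq with h2 | h2
    · have h3 : ⌊s⌋₊ = n := (Nat.floor_eq_iff ((Nat.cast_nonneg n).trans h1)).2 ⟨h1, h2⟩
      have h4 : Int.fract s = s - n := by
        rw [Int.fract_eq_iff]
        exact ⟨by linarith, by linarith, n, by simp⟩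
      simp only [hΦ, hG, halfB2, sixthB3, h3, h4]
    · have h3 : s = ((n + 1 : ℕ) : ℝ) := by rw [h2]; push_cast; ring
      rw [h3, hΦn, Finset.sum_Icc_succ_top (by omega)]
      simp only [hG]
      push_cast
      ring
  have hGd : ∀ n : ℕ, ∀ s : ℝ, 0 < s → HasDerivAt (G n)
      ((s - n) * (s - n - 1 / 2) * (s - n - 1) / 6 * f₃ s) s := by
    intro n s hs
    have hu : HasDerivAt (fun s : ℝ => s - (n : ℝ)) 1 s := (hasDerivAt_id s).sub_const _
    have h := (((((hF s hs).const_sub (∑ k ∈ Finset.Icc 1 n, f k)).sub_const C).add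
      ((hu.sub_const (1 / 2)).mul (hf s hs))).sub
      (((((hu.pow 2).sub hu).add_const (1 / 6)).div_const 2).mul (hf₁ s hs))).add
      ((((hu.mul (hu.sub_const (1 / 2))).mul (hu.sub_const 1)).div_const 6).mul (hf₂ s hs))
    refine h.congr_deriv ?_
    simp only [Pi.mul_apply, Pi.sub_apply, Pi.pow_apply]
    push_cast
    ring
  refine abs_le_of_local_increments (Φ := Φ) hy ?_ ?_ (hb0.comp tendsto_natCast_atTop_atTop)
  · intro n s t hs hst hns htn
    rw [hΦG n s hns (hst.trans htn), hΦG n t (hns.trans hst) htn]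
    have hbound : ∀ r ∈ Set.Icc s t,
        |(r - n) * (r - n - 1 / 2) * (r - n - 1) / 6 * f₃ r| ≤ b' r := by
      intro r hr
      have h1 := abs_cubic_le (u := r - n) (by linarith [hr.1]) (by linarith [hr.2])
      have h2 := hb' r (hs.trans hr.1)
      rw [abs_mul]
      have := mul_le_mul_of_nonneg_right h1 (abs_nonneg (f₃ r))
      linarith
    have hpos : ∀ r ∈ Set.Icc s t, 0 < r := fun r hr => by linarith [hr.1]
    have hm1 : MonotoneOn (fun r => b r - G n r) (Set.Icc s t) := by
      refine monotoneOn_of_hasDerivWithinAt_nonneg (convex_Icc s t)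
        (f' := fun r => b' r - (r - n) * (r - n - 1 / 2) * (r - n - 1) / 6 * f₃ r)
        (fun r hr => ((hb r (hpos r hr)).sub (hGd n r (hpos r hr))).continuousAt.continuousWithinAt)
        (fun r hr => ((hb r (hpos r (interior_subset hr))).sub
          (hGd n r (hpos r (interior_subset hr)))).hasDerivWithinAt) ?_
      intro r hr
      linarith [(abs_le.1 (hbound r (interior_subset hr))).2]
    have hm2 : MonotoneOn (fun r => b r + G n r) (Set.Icc s t) := by
      refine monotoneOn_of_hasDerivWithinAt_nonneg (convex_Icc s t)
        (f' := fun r => b' r + (r - n) * (r - n - 1 / 2) * (r - n - 1) / 6 * f₃ r)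
        (fun r hr => ((hb r (hpos r hr)).add (hGd n r (hpos r hr))).continuousAt.continuousWithinAt)
        (fun r hr => ((hb r (hpos r (interior_subset hr))).add
          (hGd n r (hpos r (interior_subset hr)))).hasDerivWithinAt) ?_
      intro r hr
      linarith [(abs_le.1 (hbound r (interior_subset hr))).1]
    have e1 := hm1 (Set.left_mem_Icc.2 hst) (Set.right_mem_Icc.2 hst) hst
    have e2 := hm2 (Set.left_mem_Icc.2 hst) (Set.right_mem_Icc.2 hst) hst
    dsimp only at e1 e2
    rw [abs_le]
    constructor <;> linarith
  · have h := (((hlim.sub_const C).sub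
      ((hf0.comp tendsto_natCast_atTop_atTop).const_mul (1 / 2))).sub
      ((hf₁0.comp tendsto_natCast_atTop_atTop).const_mul (1 / 12)))
    simp only [sub_self, mul_zero] at h
    refine h.congr fun n => ?_
    rw [hΦn]
    rfl

/-! ### Harmonic and logarithmic sums -/

/-- The error term in `∑_{k ≤ s} 1 / k = log s + γ - ({s} - 1 / 2) / s + harmErr s`. -/
noncomputable def harmErr (s : ℝ) : ℝ :=
  ∑ k ∈ Finset.Icc 1 ⌊s⌋₊, 1 / (k : ℝ) - Real.log s - Real.eulerMascheroniConstant
    + (Int.fract s - 1 / 2) / s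

/-- The error term in
`∑_{k ≤ s} (log k) / k = (log s)² / 2 + γ₁ - ({s} - 1 / 2) (log s) / s + logErr s`. -/
noncomputable def logErr (s : ℝ) : ℝ :=
  ∑ k ∈ Finset.Icc 1 ⌊s⌋₊, Real.log k / (k : ℝ) - Real.log s ^ 2 / 2 - stieltjesOne
    + (Int.fract s - 1 / 2) * Real.log s / s

lemma tendsto_sum_inv_sub_log :
    Tendsto (fun n : ℕ => ∑ k ∈ Finset.Icc 1 n, 1 / (k : ℝ) - Real.log n) atTop
      (𝓝 Real.eulerMascheroniConstant) := by
  refine Real.tendsto_harmonic_sub_log.congr fun n => ?_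
  rw [harmonic_eq_sum_Icc]
  push_cast
  simp

lemma hasDerivAt_log_div_pow (a c : ℝ) (n : ℕ) {t : ℝ} (ht : 0 < t) :
    HasDerivAt (fun t : ℝ => (a * Real.log t + c) / t ^ n)
      ((-(n * a) * Real.log t + (a - n * c)) / t ^ (n + 1)) t := by
  have h := (((Real.hasDerivAt_log ht.ne').const_mul a).add_const c).fun_div
    (hasDerivAt_pow n t) (pow_ne_zero n ht.ne')
  refine h.congr_deriv ?_
  have := ht.ne'
  rcases n with _ | n
  · simp; field_simp
  · field_simp
    simp
    ring

lemma tendsto_log_div_pow (a c : ℝ) {n : ℕ} (hn : n ≠ 0) :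
    Tendsto (fun t : ℝ => (a * Real.log t + c) / t ^ n) atTop (𝓝 0) := by
  have h1 : Tendsto (fun t : ℝ => Real.log t / t ^ n) atTop (𝓝 0) := by
    have := (isLittleO_log_rpow_atTop (r := n) (by positivity)).tendsto_div_nhds_zero
    simpa using this
  have h2 : Tendsto (fun t : ℝ => c / t ^ n) atTop (𝓝 0) :=
    tendsto_const_nhds.div_atTop (tendsto_pow_atTop hn)
  have h := (h1.const_mul a).add h2
  simp only [mul_zero, add_zero] at h
  refine h.congr fun t => ?_
  ring

theorem abs_harmErr_expansion_le {s : ℝ} (hs : 1 ≤ s) :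
    |harmErr s + halfB2 s / s ^ 2 + 2 * sixthB3 s / s ^ 3| ≤ 1 / 60 / s ^ 3 := by
  have h := abs_eulerMaclaurin_le (F := Real.log) (f := fun t => (0 * Real.log t + 1) / t ^ 1)
    (f₁ := fun t => (0 * Real.log t + (-1)) / t ^ 2)
    (f₂ := fun t => (0 * Real.log t + 2) / t ^ 3)
    (f₃ := fun t => (0 * Real.log t + (-6)) / t ^ 4)
    (b := fun t => (0 * Real.log t + (-(1 / 60))) / t ^ 3)
    (b' := fun t => (0 * Real.log t + 1 / 20) / t ^ 4)
    (C := Real.eulerMascheroniConstant) hs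
    (fun t ht => (Real.hasDerivAt_log ht.ne').congr_deriv (by simp))
    (fun t ht => (hasDerivAt_log_div_pow 0 1 1 ht).congr_deriv (by norm_num))
    (fun t ht => (hasDerivAt_log_div_pow 0 (-1) 2 ht).congr_deriv (by norm_num))
    (fun t ht => (hasDerivAt_log_div_pow 0 2 3 ht).congr_deriv (by norm_num))
    (fun t ht => (hasDerivAt_log_div_pow 0 (-(1 / 60)) 3 ht).congr_deriv (by norm_num))
    (fun t ht => by
      have ht0 : 0 < t := by linarith
      have : 0 < t ^ 4 := by positivity
      rw [abs_div, abs_of_pos this]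
      apply le_of_eq
      norm_num
      ring)
    (tendsto_sum_inv_sub_log.congr fun n => by simp)
    (tendsto_log_div_pow _ _ (by norm_num)) (tendsto_log_div_pow _ _ (by norm_num))
    (tendsto_log_div_pow _ _ (by norm_num))
  refine le_of_eq_of_le ?_ (h.trans_eq (by ring))
  congr 1
  simp only [harmErr, zero_mul, zero_add, pow_one]
  ring

theorem abs_logErr_add_le {y : ℝ} (hy : 1 ≤ y) :
    |logErr y + (1 - Real.log y) * harmErr y| ≤ 1 / 36 / y ^ 3 := by
  have hy0 : 0 < y := by linarith
  set l := Real.log y with hl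
  have h := abs_eulerMaclaurin_le (F := fun t => Real.log t ^ 2 / 2 + (1 - l) * Real.log t)
    (f := fun t => (1 * Real.log t + (1 - l)) / t ^ 1)
    (f₁ := fun t => (-1 * Real.log t + l) / t ^ 2)
    (f₂ := fun t => (2 * Real.log t + (-1 - 2 * l)) / t ^ 3)
    (f₃ := fun t => (-6 * Real.log t + (5 + 6 * l)) / t ^ 4)
    (b := fun t => (-(1 / 60) * Real.log t + (l / 60 - 7 / 360)) / t ^ 3)
    (b' := fun t => (1 / 20 * Real.log t + (1 / 24 - l / 20)) / t ^ 4)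
    (C := stieltjesOne + (1 - l) * Real.eulerMascheroniConstant) hy
    (fun t ht => by
      have h1 := Real.hasDerivAt_log ht.ne'
      refine (((h1.pow 2).div_const 2).add (h1.const_mul (1 - l))).congr_deriv ?_
      have := ht.ne'
      field_simp
      norm_num
      ring)
    (fun t ht => (hasDerivAt_log_div_pow _ _ 1 ht).congr_deriv (by norm_num))
    (fun t ht => (hasDerivAt_log_div_pow _ _ 2 ht).congr_deriv (by norm_num))
    (fun t ht => (hasDerivAt_log_div_pow _ _ 3 ht).congr_deriv (by norm_num; ring))
    (fun t ht => (hasDerivAt_log_div_pow _ _ 3 ht).congr_deriv (by norm_num; ring))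
    (fun t ht => by
      have ht0 : 0 < t := by linarith
      have : 0 < t ^ 4 := by positivity
      have hlt : l ≤ Real.log t := Real.log_le_log hy0 ht
      rw [abs_div, abs_of_pos this, div_right_comm]
      gcongr
      have : |-6 * Real.log t + (5 + 6 * l)| ≤ 6 * (Real.log t - l) + 5 := by
        rw [abs_le]; constructor <;> linarith
      linarith)
    (by
      refine (tendsto_stieltjesOneSeq.add (tendsto_sum_inv_sub_log.const_mul (1 - l))).congr
        fun n => ?_
      simp only [stieltjesOneSeq, one_mul, pow_one, add_div, Finset.sum_add_distrib]
      rw [mul_sub, Finset.mul_sum]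
      simp only [mul_one_div]
      ring)
    (tendsto_log_div_pow _ _ (by norm_num)) (tendsto_log_div_pow _ _ (by norm_num))
    (tendsto_log_div_pow _ _ (by norm_num))
  rw [← hl] at h
  have hW : |logErr y + (1 - l) * harmErr y - sixthB3 y / y ^ 3| ≤ 7 / 360 / y ^ 3 := by
    refine le_of_eq_of_le ?_ (h.trans_eq (by ring))
    congr 1
    simp only [harmErr, logErr, one_mul, pow_one, add_div, Finset.sum_add_distrib, ← hl]
    simp only [mul_add, mul_sub, Finset.mul_sum, mul_one_div]
    ring
  have h2 : |sixthB3 y / y ^ 3| ≤ 1 / 120 / y ^ 3 := by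
    have : 0 < y ^ 3 := by positivity
    rw [abs_div, abs_of_pos this]
    gcongr
    exact abs_sixthB3_le y
  have h3 := abs_add_le (logErr y + (1 - l) * harmErr y - sixthB3 y / y ^ 3) (sixthB3 y / y ^ 3)
  rw [sub_add_cancel] at h3
  refine h3.trans ((add_le_add hW h2).trans_eq ?_)
  ring

lemma abs_mul_harmErr_add_le {s : ℝ} (hs : 1 ≤ s) :
    |s * harmErr s + halfB2 s / s| ≤ 1 / 30 / s ^ 2 := by
  have hs0 : 0 < s := by linarith
  have h1 := abs_harmErr_expansion_le hs
  have h2 : |2 * sixthB3 s / s ^ 3| ≤ 1 / 60 / s ^ 3 := by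
    have : 0 < s ^ 3 := by positivity
    rw [abs_div, abs_of_pos this, abs_mul, abs_two]
    gcongr
    linarith [abs_sixthB3_le s]
  have h3 : |harmErr s + halfB2 s / s ^ 2| ≤ 1 / 30 / s ^ 3 := by
    have := abs_sub (harmErr s + halfB2 s / s ^ 2 + 2 * sixthB3 s / s ^ 3) (2 * sixthB3 s / s ^ 3)
    rw [add_sub_cancel_right] at this
    refine this.trans ((add_le_add h1 h2).trans_eq (by ring))
  have h4 : s * harmErr s + halfB2 s / s = s * (harmErr s + halfB2 s / s ^ 2) := by
    field_simp
  rw [h4, abs_mul, abs_of_pos hs0]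
  calc s * |harmErr s + halfB2 s / s ^ 2| ≤ s * (1 / 30 / s ^ 3) := by gcongr
    _ = 1 / 30 / s ^ 2 := by field_simp

lemma abs_harmErr_le {s : ℝ} (hs : 1 ≤ s) : |harmErr s| ≤ 1 / 8 / s ^ 2 := by
  have hs0 : 0 < s := by linarith
  have h1 := abs_mul_harmErr_add_le hs
  have h2 : |halfB2 s / s| ≤ 1 / 12 / s := by
    rw [abs_div, abs_of_pos hs0]
    gcongr
    exact abs_halfB2_le s
  have h3 := abs_sub (s * harmErr s + halfB2 s / s) (halfB2 s / s)
  rw [add_sub_cancel_right, abs_mul, abs_of_pos hs0] at h3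
  have h4 : 1 / 30 / s ^ 2 ≤ 1 / 30 / s := by
    gcongr
    nlinarith
  have h5 : s * |harmErr s| ≤ 1 / 8 / s := by
    have : (1 / 30 + 1 / 12) / s ≤ 1 / 8 / s := by gcongr; norm_num
    rw [add_div] at this
    linarith
  calc |harmErr s| = s * |harmErr s| / s := by field_simp
    _ ≤ 1 / 8 / s / s := by gcongr
    _ = 1 / 8 / s ^ 2 := by field_simp

/-! ### The exact formula -/

lemma natSqrt_floor {x : ℝ} (hx : 0 ≤ x) : Nat.sqrt ⌊x⌋₊ = ⌊Real.sqrt x⌋₊ := by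
  symm
  rw [Nat.floor_eq_iff (Real.sqrt_nonneg x)]
  constructor
  · apply Real.le_sqrt_of_sq_le
    have h1 : ((Nat.sqrt ⌊x⌋₊ ^ 2 : ℕ) : ℝ) ≤ ⌊x⌋₊ := by exact_mod_cast Nat.sqrt_le' _
    push_cast at h1
    exact h1.trans (Nat.floor_le hx)
  · rw [Real.sqrt_lt' (by positivity)]
    have h1 : ⌊x⌋₊ + 1 ≤ (Nat.sqrt ⌊x⌋₊ + 1) ^ 2 := Nat.lt_succ_sqrt' _
    have h2 : ((⌊x⌋₊ + 1 : ℕ) : ℝ) ≤ (((Nat.sqrt ⌊x⌋₊ + 1) ^ 2 : ℕ) : ℝ) := by exact_mod_cast h1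
    push_cast at h2
    linarith [Nat.lt_floor_add_one x]

lemma natCast_floor_eq {s : ℝ} (hs : 0 ≤ s) : (⌊s⌋₊ : ℝ) = s - Int.fract s := by
  rw [natCast_floor_eq_intCast_floor hs]
  exact (Int.self_sub_fract s).symm

theorem Delta_sub_mul_delta {x : ℝ} (hx : 1 ≤ x) :
    Delta x - x * delta x = 1 / 4
      - 2 * ∑ k ∈ Finset.Icc 1 ⌊√x⌋₊, (x / k) * harmErr (x / k)
      + 2 * x * (logErr √x + (1 - Real.log √x) * harmErr √x)
      - 2 * √x * (Int.fract √x - 1 / 2) * harmErr √x + x * harmErr √x ^ 2 := by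
  have hx0 : 0 < x := by linarith
  have hy0 : 0 < √x := Real.sqrt_pos.2 hx0
  have h1 := sum_card_divisors_mul (fun _ => 1) (by simp) ⌊x⌋₊
  have h2 := sum_card_divisors_mul (fun n => 1 / (n : ℝ)) (fun a b => by push_cast; field_simp)
    ⌊x⌋₊
  rw [natSqrt_floor hx0.le] at h1 h2
  set y := √x with hy
  have hyx : y ^ 2 = x := Real.sq_sqrt hx0.le
  set N := ⌊y⌋₊ with hN
  set H := ∑ k ∈ Finset.Icc 1 N, 1 / (k : ℝ) with hH
  set L := ∑ k ∈ Finset.Icc 1 N, Real.log k / (k : ℝ) with hL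
  set g := Real.eulerMascheroniConstant
  have hlog : Real.log x = 2 * Real.log y := by
    rw [← hyx, Real.log_pow]; norm_num
  simp only [mul_one, one_mul, Finset.sum_const, Nat.card_Icc, nsmul_eq_mul,
    Nat.add_sub_cancel, mul_one_div] at h1 h2
  have hterm : ∀ k ∈ Finset.Icc 1 N, ((⌊x⌋₊ / k : ℕ) : ℝ)
      - x * (1 / k * ∑ b ∈ Finset.Icc 1 (⌊x⌋₊ / k), 1 / (b : ℝ))
      = x * (1 - g - Real.log x) * (1 / k) + x * (Real.log k / k) - 1 / 2
        - x / k * harmErr (x / k) := by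
    intro k hk
    have hk1 : 1 ≤ k := (Finset.mem_Icc.1 hk).1
    have hk0 : (0 : ℝ) < k := by exact_mod_cast hk1
    rw [← Nat.floor_div_natCast, natCast_floor_eq (by positivity)]
    have h3 : ∑ b ∈ Finset.Icc 1 ⌊x / k⌋₊, 1 / (b : ℝ) = harmErr (x / k) + Real.log (x / k) + g
        - (Int.fract (x / k) - 1 / 2) / (x / k) := by
      unfold harmErr; ring
    rw [h3, Real.log_div hx0.ne' hk0.ne']
    field_simp
    ring
  have hsum := Finset.sum_congr rfl hterm
  simp only [Finset.sum_sub_distrib, Finset.sum_add_distrib, ← Finset.mul_sum, Finset.sum_const,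
    Nat.card_Icc, Nat.add_sub_cancel, nsmul_eq_mul] at hsum
  rw [← hH, ← hL] at hsum
  have hNy : (N : ℝ) = y - Int.fract y := natCast_floor_eq hy0.le
  have hHy : H = harmErr y + Real.log y + g - (Int.fract y - 1 / 2) / y := by
    unfold harmErr; ring
  have hLy : L = logErr y + Real.log y ^ 2 / 2 + stieltjesOne
      - (Int.fract y - 1 / 2) * Real.log y / y := by
    unfold logErr; ring
  unfold Delta delta
  rw [h1, h2]
  have hcomb : ∀ a b m : ℝ, a - x * b = m → (2 * a - (N : ℝ) ^ 2 - x * (Real.log x + 2 * g - 1))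
      - x * (2 * b - H ^ 2 - (1 / 2 * Real.log x ^ 2 + 2 * g * Real.log x + g ^ 2
        - 2 * stieltjesOne)) = 2 * m - N ^ 2 + x * H ^ 2 - x * (Real.log x + 2 * g - 1)
        + x * (1 / 2 * Real.log x ^ 2 + 2 * g * Real.log x + g ^ 2 - 2 * stieltjesOne) := by
    intro a b m hm
    rw [← hm]; ring
  rw [hcomb _ _ _ hsum, hHy, hLy, hNy, hlog, ← hyx]
  field_simp
  ring

/-- The remainder in the relation between `Δ` and `δ`. -/
noncomputable def remainder (x : ℝ) : ℝ := Delta x - x * delta x - 1 / 4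

lemma abs_remainder_add_le {x : ℝ} (hx : 1 ≤ x) :
    |remainder x + 2 * ∑ k ∈ Finset.Icc 1 ⌊√x⌋₊, (x / k) * harmErr (x / k)|
      ≤ 0.181 / √x + 1 / (64 * x) := by
  have hx0 : 0 < x := by linarith
  have hy0 : 0 < √x := Real.sqrt_pos.2 hx0
  have hy1 : 1 ≤ √x := Real.one_le_sqrt.2 hx
  have h1 := abs_logErr_add_le hy1
  have h2 := abs_harmErr_le hy1
  have h3 := Delta_sub_mul_delta hx
  unfold remainder
  rw [h3]
  set S := ∑ k ∈ Finset.Icc 1 ⌊√x⌋₊, (x / k) * harmErr (x / k)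
  set y := √x with hy
  have hyx : y ^ 2 = x := Real.sq_sqrt hx0.le
  set A := logErr y + (1 - Real.log y) * harmErr y
  set E := harmErr y
  have e1 : |2 * x * A| ≤ 1 / 18 / y := by
    rw [abs_mul, abs_of_pos (by positivity)]
    calc 2 * x * |A| ≤ 2 * x * (1 / 36 / y ^ 3) := by gcongr
      _ = 1 / 18 / y := by rw [← hyx]; field_simp; norm_num
  have e2 : |2 * y * (Int.fract y - 1 / 2) * E| ≤ 1 / 8 / y := by
    have h5 : |Int.fract y - 1 / 2| ≤ 1 / 2 := by
      rw [abs_le]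
      constructor <;> linarith [Int.fract_nonneg y, Int.fract_lt_one y]
    rw [abs_mul, abs_mul, abs_of_pos (by positivity : 0 < 2 * y)]
    calc 2 * y * |Int.fract y - 1 / 2| * |E| ≤ 2 * y * (1 / 2) * (1 / 8 / y ^ 2) := by gcongr
      _ = 1 / 8 / y := by field_simp
  have e3 : |x * E ^ 2| ≤ 1 / (64 * x) := by
    rw [abs_mul, abs_of_pos hx0, abs_pow]
    calc x * |E| ^ 2 ≤ x * (1 / 8 / y ^ 2) ^ 2 := by gcongr
      _ = 1 / (64 * x) := by rw [hyx]; field_simp; norm_num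
  have e4 : (1 / 18 + 1 / 8) / y ≤ 0.181 / y := by gcongr; norm_num
  rw [add_div] at e4
  have e5 : 1 / 4 - 2 * S + 2 * x * A - 2 * y * (Int.fract y - 1 / 2) * E + x * E ^ 2 - 1 / 4
      + 2 * S = 2 * x * A - 2 * y * (Int.fract y - 1 / 2) * E + x * E ^ 2 := by ring
  rw [e5]
  have e6 := abs_add_le (2 * x * A - 2 * y * (Int.fract y - 1 / 2) * E) (x * E ^ 2)
  have e7 := abs_sub (2 * x * A) (2 * y * (Int.fract y - 1 / 2) * E)
  linarith

lemma sum_Icc_natCast (N : ℕ) : ∑ k ∈ Finset.Icc 1 N, (k : ℝ) = N * (N + 1) / 2 := by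
  induction N with
  | zero => simp
  | succ n ih => rw [Finset.sum_Icc_succ_top (by omega), ih]; push_cast; ring

lemma one_le_div_of_mem {x : ℝ} (hx : 1 ≤ x) {k : ℕ} (hk : k ∈ Finset.Icc 1 ⌊√x⌋₊) :
    0 < (k : ℝ) ∧ (k : ℝ) ≤ √x ∧ 1 ≤ x / k := by
  rw [Finset.mem_Icc] at hk
  have hk0 : (0 : ℝ) < k := by exact_mod_cast hk.1
  have hk2 : (k : ℝ) ≤ √x := (Nat.le_floor_iff (Real.sqrt_nonneg x)).1 hk.2
  refine ⟨hk0, hk2, ?_⟩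
  rw [le_div_iff₀ hk0, one_mul]
  have h1 : 1 ≤ √x := Real.one_le_sqrt.2 hx
  have h2 : √x ^ 2 = x := Real.sq_sqrt (by linarith)
  nlinarith

theorem abs_remainder_le {x : ℝ} (hx : 1 ≤ x) :
    |remainder x| ≤ 1 / 8 + 0.316 / √x + 1 / (64 * x) := by
  have hx0 : 0 < x := by linarith
  have hy0 : 0 < √x := Real.sqrt_pos.2 hx0
  have h1 := abs_remainder_add_le hx
  set S := ∑ k ∈ Finset.Icc 1 ⌊√x⌋₊, (x / k) * harmErr (x / k) with hS
  have h2 : |2 * S| ≤ 1 / 8 + 1 / 8 / √x := by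
    have h3 : |S| ≤ ∑ k ∈ Finset.Icc 1 ⌊√x⌋₊, (k : ℝ) * (1 / 8 / x) := by
      refine (Finset.abs_sum_le_sum_abs _ _).trans (Finset.sum_le_sum fun k hk => ?_)
      obtain ⟨hk0, hk1, hk2⟩ := one_le_div_of_mem hx hk
      rw [abs_mul, abs_of_pos (by positivity)]
      calc x / k * |harmErr (x / k)| ≤ x / k * (1 / 8 / (x / k) ^ 2) := by
            gcongr; exact abs_harmErr_le hk2
        _ = k * (1 / 8 / x) := by field_simp
    rw [← Finset.sum_mul, sum_Icc_natCast] at h3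
    have hN : (⌊√x⌋₊ : ℝ) ≤ √x := Nat.floor_le hy0.le
    have hyx : √x ^ 2 = x := Real.sq_sqrt hx0.le
    rw [abs_mul, abs_two]
    calc 2 * |S| ≤ 2 * (√x * (√x + 1) / 2 * (1 / 8 / x)) := by
          refine mul_le_mul_of_nonneg_left (h3.trans ?_) (by norm_num)
          gcongr
      _ = 1 / 8 + 1 / 8 / √x := by
          nth_rewrite 3 [← hyx]
          field_simp
  have h3 := abs_sub (remainder x + 2 * S) (2 * S)
  rw [add_sub_cancel_right] at h3
  have h4 : (0.181 + 1 / 8) / √x ≤ 0.316 / √x := by gcongr; norm_num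
  rw [add_div] at h4
  linarith

/-- Reduction of the remainder to a weighted sum of periodic Bernoulli polynomials. -/
theorem abs_remainder_le_sum_halfB2 {x : ℝ} (hx : 1 ≤ x) :
    |remainder x| ≤ 2 / x * |∑ k ∈ Finset.Icc 1 ⌊√x⌋₊, (k : ℝ) * halfB2 (x / k)|
      + 0.248 / √x + 1 / (64 * x) := by
  have hx0 : 0 < x := by linarith
  have hy0 : 0 < √x := Real.sqrt_pos.2 hx0
  have h1 := abs_remainder_add_le hx
  set S := ∑ k ∈ Finset.Icc 1 ⌊√x⌋₊, (x / k) * harmErr (x / k) with hS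
  set B := ∑ k ∈ Finset.Icc 1 ⌊√x⌋₊, (k : ℝ) * halfB2 (x / k) with hB
  have hyx : √x ^ 2 = x := Real.sq_sqrt hx0.le
  have h2 : |S + B / x| ≤ 1 / 30 / √x := by
    rw [hS, hB, Finset.sum_div, ← Finset.sum_add_distrib]
    have h3 : ∀ k ∈ Finset.Icc 1 ⌊√x⌋₊,
        |x / k * harmErr (x / k) + k * halfB2 (x / k) / x| ≤ 1 / 30 / x := by
      intro k hk
      obtain ⟨hk0, hk1, hk2⟩ := one_le_div_of_mem hx hk
      have h4 := abs_mul_harmErr_add_le hk2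
      have h5 : halfB2 (x / k) / (x / k) = k * halfB2 (x / k) / x := by field_simp
      rw [h5] at h4
      refine h4.trans ?_
      have h6 : x ≤ (x / k) ^ 2 := by
        rw [div_pow, le_div_iff₀ (by positivity)]
        have : (k : ℝ) ^ 2 ≤ x := by rw [← hyx]; gcongr
        nlinarith
      gcongr
    refine (Finset.abs_sum_le_sum_abs _ _).trans ((Finset.sum_le_card_nsmul _ _ _ h3).trans ?_)
    rw [Nat.card_Icc, Nat.add_sub_cancel, nsmul_eq_mul]
    calc (⌊√x⌋₊ : ℝ) * (1 / 30 / x) ≤ √x * (1 / 30 / √x ^ 2) := by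
          rw [hyx]; gcongr; exact Nat.floor_le hy0.le
      _ = 1 / 30 / √x := by field_simp
  have h3 : remainder x = (remainder x + 2 * S) - 2 * (S + B / x) + 2 / x * B := by ring
  have h4 := abs_add_le ((remainder x + 2 * S) - 2 * (S + B / x)) (2 / x * B)
  have h5 := abs_sub (remainder x + 2 * S) (2 * (S + B / x))
  rw [← h3, abs_mul, abs_of_pos (by positivity : 0 < 2 / x)] at h4
  rw [abs_mul, abs_two] at h5
  have h6 : (0.181 + 2 * (1 / 30)) / √x ≤ 0.248 / √x := by gcongr; norm_num
  rw [add_div, mul_div_assoc] at h6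
  linarith

/-! ### The Kusmin–Landau inequality -/

/-- The additive character `t ↦ exp (2πit)`. -/
noncomputable def expCircle (t : ℝ) : ℂ := Complex.exp ((2 * Real.pi * t : ℝ) * Complex.I)

lemma norm_expCircle (t : ℝ) : ‖expCircle t‖ = 1 := Complex.norm_exp_ofReal_mul_I _

lemma expCircle_re (t : ℝ) : (expCircle t).re = Real.cos (2 * Real.pi * t) :=
  Complex.exp_ofReal_mul_I_re _

lemma expCircle_add (s t : ℝ) : expCircle (s + t) = expCircle s * expCircle t := by
  unfold expCircle
  rw [← Complex.exp_add]
  congr 1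
  push_cast
  ring

lemma expCircle_natCast (n : ℕ) : expCircle n = 1 := by
  unfold expCircle
  rw [← Complex.exp_nat_mul_two_pi_mul_I n]
  congr 1
  push_cast
  ring

/-- The reciprocal of `1 - exp (-2πig)`. -/
noncomputable def landauCoeff (g : ℝ) : ℂ :=
  1 / 2 - Complex.I / 2 * (Real.cos (Real.pi * g) / Real.sin (Real.pi * g) : ℝ)

lemma landauCoeff_eq {g : ℝ} (hg : Real.sin (Real.pi * g) ≠ 0) :
    landauCoeff g = -Complex.I / (2 * (Real.sin (Real.pi * g) : ℝ))
      * Complex.exp ((Real.pi * g : ℝ) * Complex.I) := by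
  have h : (Real.sin (Real.pi * g) : ℂ) ≠ 0 := by exact_mod_cast hg
  rw [Complex.exp_mul_I, ← Complex.ofReal_cos, ← Complex.ofReal_sin]
  unfold landauCoeff
  rw [Complex.ofReal_div]
  field_simp
  linear_combination (Real.sin (Real.pi * g) : ℂ) * Complex.I_sq

lemma landauCoeff_mul {g : ℝ} (hg : Real.sin (Real.pi * g) ≠ 0) :
    landauCoeff g * (1 - expCircle (-g)) = 1 := by
  have h : (Real.sin (Real.pi * g) : ℂ) ≠ 0 := by exact_mod_cast hg
  have h1 : (1 : ℂ) - expCircle (-g) = Complex.exp (-((Real.pi * g : ℝ) * Complex.I))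
      * (2 * Complex.I * (Real.sin (Real.pi * g) : ℝ)) := by
    have e1 : (2 : ℂ) * Complex.I * (Real.sin (Real.pi * g) : ℝ)
        = Complex.exp ((Real.pi * g : ℝ) * Complex.I)
          - Complex.exp (-((Real.pi * g : ℝ) * Complex.I)) := by
      rw [← neg_mul, Complex.exp_mul_I, Complex.exp_mul_I, Complex.cos_neg, Complex.sin_neg,
        Complex.ofReal_sin]
      ring
    rw [e1, mul_sub, ← Complex.exp_add, ← Complex.exp_add, neg_add_cancel, Complex.exp_zero]
    unfold expCircle
    congr 2
    push_cast
    ring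
  rw [landauCoeff_eq hg, h1]
  have h2 : Complex.exp ((Real.pi * g : ℝ) * Complex.I)
      * Complex.exp (-((Real.pi * g : ℝ) * Complex.I)) = 1 := by
    rw [← Complex.exp_add, add_neg_cancel, Complex.exp_zero]
  calc _ = -Complex.I ^ 2 * (Complex.exp ((Real.pi * g : ℝ) * Complex.I)
      * Complex.exp (-((Real.pi * g : ℝ) * Complex.I))) := by field_simp
    _ = 1 := by rw [h2, Complex.I_sq]; norm_num

lemma two_mul_le_sin_pi_mul {g δ : ℝ} (hδ : 0 < δ) (h1 : δ ≤ g) (h2 : g ≤ 1 - δ) :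
    2 * δ ≤ Real.sin (Real.pi * g) := by
  have hπ := Real.pi_pos
  rcases le_total g (1 / 2) with h | h
  · have := Real.mul_le_sin (x := Real.pi * g) (by nlinarith) (by nlinarith)
    have e : 2 / Real.pi * (Real.pi * g) = 2 * g := by field_simp
    linarith
  · have := Real.mul_le_sin (x := Real.pi - Real.pi * g) (by nlinarith) (by nlinarith)
    rw [Real.sin_pi_sub] at this
    have e : 2 / Real.pi * (Real.pi - Real.pi * g) = 2 * (1 - g) := by field_simp
    linarith

lemma norm_landauCoeff_le {g δ : ℝ} (hδ : 0 < δ) (h1 : δ ≤ g) (h2 : g ≤ 1 - δ) :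
    ‖landauCoeff g‖ ≤ 1 / (4 * δ) := by
  have hs := two_mul_le_sin_pi_mul hδ h1 h2
  have hs0 : 0 < Real.sin (Real.pi * g) := by linarith
  rw [landauCoeff_eq hs0.ne', norm_mul, Complex.norm_exp_ofReal_mul_I, mul_one, norm_div, norm_neg,
    Complex.norm_I, norm_mul, Complex.norm_real, Complex.norm_two, Real.norm_of_nonneg hs0.le]
  apply one_div_le_one_div_of_le (by positivity)
  linarith

lemma abs_cot_le {g δ : ℝ} (hδ : 0 < δ) (h1 : δ ≤ g) (h2 : g ≤ 1 - δ) :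
    |Real.cos (Real.pi * g) / Real.sin (Real.pi * g)| ≤ 1 / (2 * δ) := by
  have hs := two_mul_le_sin_pi_mul hδ h1 h2
  have hs0 : 0 < Real.sin (Real.pi * g) := by linarith
  rw [abs_div, abs_of_pos hs0]
  gcongr
  exact Real.abs_cos_le_one _

lemma cot_pi_mul_anti {g g' : ℝ} (h0 : 0 < g') (h : g' ≤ g) (h1 : g < 1) :
    Real.cos (Real.pi * g) / Real.sin (Real.pi * g)
      ≤ Real.cos (Real.pi * g') / Real.sin (Real.pi * g') := by
  have hπ := Real.pi_pos
  have s1 : 0 < Real.sin (Real.pi * g) :=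
    Real.sin_pos_of_pos_of_lt_pi (by nlinarith) (by nlinarith)
  have s2 : 0 < Real.sin (Real.pi * g') :=
    Real.sin_pos_of_pos_of_lt_pi (by nlinarith) (by nlinarith)
  rw [div_le_div_iff₀ s1 s2]
  have := Real.sin_nonneg_of_nonneg_of_le_pi (x := Real.pi * g - Real.pi * g')
    (by nlinarith) (by nlinarith)
  rw [Real.sin_sub] at this
  linarith

/-- The Kusmin–Landau inequality. -/
theorem norm_sum_expCircle_le {φ : ℕ → ℝ} {a b : ℕ} {δ : ℝ} (hδ : 0 < δ) (hab : a ≤ b)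
    (hg : ∀ k, a ≤ k → k ≤ b → δ ≤ φ k - φ (k + 1) ∧ φ k - φ (k + 1) ≤ 1 - δ)
    (hanti : ∀ k, a ≤ k → k < b → φ (k + 1) - φ (k + 1 + 1) ≤ φ k - φ (k + 1)) :
    ‖∑ k ∈ Finset.Icc a b, expCircle (φ k)‖ ≤ 1 / δ := by
  set g : ℕ → ℝ := fun k => φ k - φ (k + 1) with hgdef
  set c : ℕ → ℝ := fun k => Real.cos (Real.pi * g k) / Real.sin (Real.pi * g k) with hc
  have hstep : ∀ k, a ≤ k → k ≤ b → expCircle (φ k)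
      = landauCoeff (g k) * (expCircle (φ k) - expCircle (φ (k + 1))) := by
    intro k h1 h2
    have hs := two_mul_le_sin_pi_mul hδ (hg k h1 h2).1 (hg k h1 h2).2
    have h3 : φ (k + 1) = φ k + -g k := by simp only [hgdef]; ring
    rw [h3, expCircle_add]
    have := landauCoeff_mul (g := g k) (by linarith)
    linear_combination (-expCircle (φ k)) * this
  have key : ∀ n, a ≤ n → n ≤ b →
      ‖∑ k ∈ Finset.Icc a n, expCircle (φ k) + landauCoeff (g n) * expCircle (φ (n + 1))‖
        ≤ 1 / (4 * δ) + (c n - c a) / 2 := by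
    intro n hn
    induction n, hn using Nat.le_induction with
    | base =>
      intro h
      have e : ∑ k ∈ Finset.Icc a a, expCircle (φ k) + landauCoeff (g a) * expCircle (φ (a + 1))
          = landauCoeff (g a) * expCircle (φ a) := by
        rw [Finset.Icc_self, Finset.sum_singleton]
        linear_combination hstep a le_rfl h
      rw [e, norm_mul, norm_expCircle, mul_one, sub_self, zero_div, add_zero]
      exact norm_landauCoeff_le hδ (hg a le_rfl h).1 (hg a le_rfl h).2
    | succ n hn ih =>
      intro h
      have ih := ih (by omega)
      have e : ∑ k ∈ Finset.Icc a (n + 1), expCircle (φ k)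
          + landauCoeff (g (n + 1)) * expCircle (φ (n + 1 + 1))
          = (∑ k ∈ Finset.Icc a n, expCircle (φ k) + landauCoeff (g n) * expCircle (φ (n + 1)))
            + (landauCoeff (g (n + 1)) - landauCoeff (g n)) * expCircle (φ (n + 1)) := by
        rw [Finset.sum_Icc_succ_top (by omega)]
        linear_combination hstep (n + 1) (by omega) h
      have hcn : c n ≤ c (n + 1) := by
        refine cot_pi_mul_anti ?_ (hanti n hn (by omega)) ?_
        · linarith [(hg (n + 1) (by omega) h).1]
        · linarith [(hg n hn (by omega)).2]
      have hd : landauCoeff (g (n + 1)) - landauCoeff (g n)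
          = -Complex.I / 2 * ((c (n + 1) - c n : ℝ) : ℂ) := by
        simp only [landauCoeff, hc]
        push_cast
        ring
      rw [e]
      refine (norm_add_le _ _).trans ?_
      rw [norm_mul, norm_expCircle, mul_one, hd, norm_mul, norm_div, norm_neg, Complex.norm_I,
        Complex.norm_two, Complex.norm_real, Real.norm_of_nonneg (by linarith)]
      linarith
  have h1 := key b hab le_rfl
  have h2 := norm_landauCoeff_le hδ (hg b hab le_rfl).1 (hg b hab le_rfl).2
  have h3 := (abs_le.1 (abs_cot_le hδ (hg b hab le_rfl).1 (hg b hab le_rfl).2)).2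
  have h4 := (abs_le.1 (abs_cot_le hδ (hg a le_rfl hab).1 (hg a le_rfl hab).2)).1
  have h5 := norm_sub_le (∑ k ∈ Finset.Icc a b, expCircle (φ k)
    + landauCoeff (g b) * expCircle (φ (b + 1))) (landauCoeff (g b) * expCircle (φ (b + 1)))
  rw [add_sub_cancel_right, norm_mul, norm_expCircle, mul_one] at h5
  have e1 : 1 / (4 * δ) = 1 / δ / 4 := by field_simp
  have e2 : 1 / (2 * δ) = 1 / δ / 2 := by field_simp
  simp only [hc] at h1
  rw [e1] at h1 h2
  rw [e2] at h3 h4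
  linarith

lemma norm_sum_natCast_mul_le {z : ℕ → ℂ} {a b : ℕ} {T : ℝ} (hab : a ≤ b)
    (h : ∀ j, a ≤ j → j ≤ b → ‖∑ k ∈ Finset.Icc j b, z k‖ ≤ T) :
    ‖∑ k ∈ Finset.Icc a b, (k : ℂ) * z k‖ ≤ b * T := by
  rcases Nat.eq_zero_or_pos b with hb | hb
  · subst hb
    have : a = 0 := by omega
    subst this
    simp
  have h1 : ∑ k ∈ Finset.Icc a b, (k : ℂ) * z k
      = ∑ j ∈ Finset.Icc 1 b, ∑ k ∈ Finset.Icc (max j a) b, z k := by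
    have h2 : ∀ k ∈ Finset.Icc a b, (k : ℂ) * z k
        = ∑ j ∈ Finset.Icc 1 b, if j ≤ k then z k else 0 := by
      intro k hk
      rw [Finset.mem_Icc] at hk
      rw [← Finset.sum_filter, Finset.sum_const, nsmul_eq_mul]
      have : (Finset.Icc 1 b).filter (fun j => j ≤ k) = Finset.Icc 1 k := by
        ext j; simp only [Finset.mem_filter, Finset.mem_Icc]; omega
      rw [this, Nat.card_Icc, Nat.add_sub_cancel]
    rw [Finset.sum_congr rfl h2, Finset.sum_comm]
    refine Finset.sum_congr rfl fun j _ => ?_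
    rw [← Finset.sum_filter]
    congr 1
    ext k
    simp only [Finset.mem_filter, Finset.mem_Icc]
    omega
  rw [h1]
  refine (norm_sum_le _ _).trans ((Finset.sum_le_card_nsmul _ _ T fun j hj => ?_).trans ?_)
  · rw [Finset.mem_Icc] at hj
    exact h _ (le_max_right _ _) (by omega)
  · rw [Nat.card_Icc, Nat.add_sub_cancel, nsmul_eq_mul]

/-! ### The sums `∑ k exp (2πi X / k)` -/

/-- The decrement `X / k - X / (k + 1)`. -/
noncomputable def gap (X : ℝ) (k : ℕ) : ℝ := X / (k * (k + 1))

lemma gap_eq (X : ℝ) {k : ℕ} (hk : 1 ≤ k) : X / k - X / (k + 1 : ℕ) = gap X k := by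
  have : (0 : ℝ) < k := by exact_mod_cast hk
  unfold gap
  push_cast
  field_simp
  ring

lemma gap_anti {X : ℝ} (hX : 0 < X) {j k : ℕ} (hj : 1 ≤ j) (hjk : j ≤ k) :
    gap X k ≤ gap X j := by
  have h1 : (0 : ℝ) < j := by exact_mod_cast hj
  have h2 : (j : ℝ) ≤ k := by exact_mod_cast hjk
  unfold gap
  gcongr

lemma gap_sub_gap (X : ℝ) {k : ℕ} (hk : 1 ≤ k) :
    gap X k - gap X (k + 1) = 2 * gap X (k + 1) / k := by
  have : (0 : ℝ) < k := by exact_mod_cast hk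
  unfold gap
  push_cast
  field_simp
  ring

lemma eq_Icc_of_convex {s : Finset ℕ} (hs : s.Nonempty)
    (h : ∀ i ∈ s, ∀ k ∈ s, ∀ j, i ≤ j → j ≤ k → j ∈ s) :
    ∃ a b, a ≤ b ∧ s = Finset.Icc a b := by
  refine ⟨s.min' hs, s.max' hs, s.min'_le_max' hs, ?_⟩
  ext j
  rw [Finset.mem_Icc]
  exact ⟨fun hj => ⟨s.min'_le j hj, s.le_max' j hj⟩,
    fun hj => h _ (s.min'_mem hs) _ (s.max'_mem hs) j hj.1 hj.2⟩

lemma norm_sum_away_le {X κ δ : ℝ} (hX : 0 < X) (hκ : 0 < κ) (hδ : 0 < δ) (m : ℕ)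
    {s : Finset ℕ} (h1 : ∀ k ∈ s, 1 ≤ k) (hk : ∀ k ∈ s, (k : ℝ) ≤ κ)
    (h : ∀ i ∈ s, ∀ k ∈ s, ∀ j, i ≤ j → j ≤ k → j ∈ s)
    (hg : ∀ k ∈ s, m + δ ≤ gap X k ∧ gap X k ≤ m + 1 - δ) :
    ‖∑ k ∈ s, (k : ℂ) * expCircle (X / k)‖ ≤ κ / δ := by
  rcases s.eq_empty_or_nonempty with hs | hs
  · rw [hs]; simp; positivity
  obtain ⟨a, b, hab, rfl⟩ := eq_Icc_of_convex hs h
  have ha : 1 ≤ a := h1 a (Finset.left_mem_Icc.2 hab)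
  set φ : ℕ → ℝ := fun k => X / k + (m * k : ℕ) with hφ
  have hdiff : ∀ k, 1 ≤ k → φ k - φ (k + 1) = gap X k - m := by
    intro k hk
    rw [← gap_eq X hk]
    simp only [hφ]
    push_cast
    ring
  have he : ∀ k : ℕ, expCircle (X / k) = expCircle (φ k) := by
    intro k
    simp only [hφ]
    rw [expCircle_add, expCircle_natCast, mul_one]
  simp_rw [he]
  have hb : (b : ℝ) ≤ κ := hk b (Finset.right_mem_Icc.2 hab)
  refine (norm_sum_natCast_mul_le (T := 1 / δ) hab fun j haj hjb => ?_).trans ?_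
  · refine norm_sum_expCircle_le hδ hjb (fun k hjk hkb => ?_) (fun k hjk hkb => ?_)
    · have := hg k (Finset.mem_Icc.2 ⟨by omega, hkb⟩)
      rw [hdiff k (by omega)]
      constructor <;> linarith
    · rw [hdiff k (by omega), hdiff (k + 1) (by omega)]
      linarith [gap_anti hX (by omega : 1 ≤ k) (Nat.le_succ k)]
  · rw [mul_one_div]
    gcongr

lemma norm_sum_near_le {X κ δ m α : ℝ} (hκ : 0 < κ) (hδ : 0 < δ) (hm : 0 < m)
    (hrel : δ ^ 2 * κ = m)
    {s : Finset ℕ} (h1 : ∀ k ∈ s, 1 ≤ k) (hk : ∀ k ∈ s, (k : ℝ) ≤ κ)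
    (h : ∀ i ∈ s, ∀ k ∈ s, ∀ j, i ≤ j → j ≤ k → j ∈ s) (hgm : ∀ k ∈ s, m ≤ gap X k)
    (hg : ∀ k ∈ s, α ≤ gap X k ∧ gap X k ≤ α + δ) :
    ‖∑ k ∈ s, (k : ℂ) * expCircle (X / k)‖ ≤ κ * (1 / (2 * δ) + 1) := by
  rcases s.eq_empty_or_nonempty with hs | hs
  · rw [hs]; simp; positivity
  obtain ⟨a, b, hab, rfl⟩ := eq_Icc_of_convex hs h
  have hcount : ∀ n, a ≤ n → n ≤ b → ((n : ℝ) - a) * (2 * m / κ) ≤ gap X a - gap X n := by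
    intro n hn
    induction n, hn using Nat.le_induction with
    | base => intro _; simp
    | succ n hn ih =>
      intro hnb
      have ih := ih (by omega)
      have hn1 : 1 ≤ n := h1 n (Finset.mem_Icc.2 ⟨hn, by omega⟩)
      have hn0 : (0 : ℝ) < n := by exact_mod_cast hn1
      have h2 := gap_sub_gap X hn1
      have h3 : 2 * m / κ ≤ 2 * gap X (n + 1) / n := by
        have h4 := hgm (n + 1) (Finset.mem_Icc.2 ⟨by omega, hnb⟩)
        have h5 := hk n (Finset.mem_Icc.2 ⟨hn, by omega⟩)
        have : 0 < gap X (n + 1) := by linarith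
        gcongr
      push_cast
      linarith
  have h2 := hcount b hab le_rfl
  have h3 := (hg a (Finset.left_mem_Icc.2 hab)).2
  have h4 := (hg b (Finset.right_mem_Icc.2 hab)).1
  have h5 : (b : ℝ) - a ≤ 1 / (2 * δ) := by
    have h6 : ((b : ℝ) - a) * (2 * m / κ) ≤ δ := by linarith
    rw [← hrel] at h6
    have h7 : ((b : ℝ) - a) * (2 * (δ ^ 2 * κ) / κ) = ((b : ℝ) - a) * (2 * δ) * δ := by
      field_simp
    rw [h7] at h6
    rw [le_div_iff₀ (by positivity)]
    by_contra! hc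
    nlinarith
  have hcard : ((Finset.Icc a b).card : ℝ) = (b : ℝ) - a + 1 := by
    rw [Nat.card_Icc, Nat.cast_sub (by omega)]
    push_cast
    ring
  refine (norm_sum_le _ _).trans ((Finset.sum_le_card_nsmul _ _ κ fun k hks => ?_).trans ?_)
  · rw [norm_mul, norm_expCircle, mul_one, Complex.norm_natCast]
    exact hk k hks
  · rw [nsmul_eq_mul, hcard, mul_comm]
    gcongr

lemma norm_sum_block_le {X κ δ : ℝ} {m : ℕ} (hm : 1 ≤ m) (hκ : 0 < κ) (hδ : 0 < δ)
    (hX : κ ^ 2 * m = X) (hrel : δ ^ 2 * κ = m) {a b : ℕ} (ha : 1 ≤ a) :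
    ‖∑ k ∈ (Finset.Icc a b).filter (fun k => ⌊gap X k⌋₊ = m), (k : ℂ) * expCircle (X / k)‖
      ≤ κ * (2 / δ + 2) := by
  have hm0 : (0 : ℝ) < m := by exact_mod_cast hm
  have hX0 : 0 < X := by rw [← hX]; positivity
  set s := (Finset.Icc a b).filter (fun k => ⌊gap X k⌋₊ = m) with hs
  have hs1 : ∀ k ∈ s, 1 ≤ k := fun k hk =>
    ha.trans (Finset.mem_Icc.1 (Finset.mem_filter.1 hk).1).1
  have hsg : ∀ k ∈ s, (m : ℝ) ≤ gap X k ∧ gap X k < m + 1 := by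
    intro k hk
    exact (Nat.floor_eq_iff' (by omega)).1 (Finset.mem_filter.1 hk).2
  have hsκ : ∀ k ∈ s, (k : ℝ) ≤ κ := by
    intro k hk
    have hk0 : (0 : ℝ) < k := by exact_mod_cast hs1 k hk
    have h1 := (hsg k hk).1
    unfold gap at h1
    rw [le_div_iff₀ (by positivity), ← hX] at h1
    have h2 : (k : ℝ) ^ 2 * m ≤ κ ^ 2 * m := by nlinarith
    exact le_of_sq_le_sq (le_of_mul_le_mul_right h2 hm0) hκ.le
  have hconv : ∀ i ∈ s, ∀ k ∈ s, ∀ j, i ≤ j → j ≤ k →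
      j ∈ s ∧ gap X k ≤ gap X j ∧ gap X j ≤ gap X i := by
    intro i hi k hk j hij hjk
    have h1 := gap_anti hX0 (hs1 i hi) hij
    have h2 := gap_anti hX0 ((hs1 i hi).trans hij) hjk
    refine ⟨Finset.mem_filter.2 ⟨?_, ?_⟩, h2, h1⟩
    · have h3 := Finset.mem_Icc.1 (Finset.mem_filter.1 hi).1
      have h4 := Finset.mem_Icc.1 (Finset.mem_filter.1 hk).1
      exact Finset.mem_Icc.2 ⟨by omega, by omega⟩
    · rw [Nat.floor_eq_iff' (by omega)]
      exact ⟨(hsg k hk).1.trans h2, h1.trans_lt (hsg i hi).2⟩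
  have e1 := norm_sum_near_le (s := s.filter (fun k => gap X k < m + δ)) (α := m) hκ hδ hm0 hrel
    (fun k hk => hs1 k (Finset.filter_subset _ _ hk))
    (fun k hk => hsκ k (Finset.filter_subset _ _ hk))
    (fun i hi k hk j hij hjk => by
      rw [Finset.mem_filter] at hi hk ⊢
      have := hconv i hi.1 k hk.1 j hij hjk
      exact ⟨this.1, by linarith⟩)
    (fun k hk => (hsg k (Finset.filter_subset _ _ hk)).1)
    (fun k hk => by
      rw [Finset.mem_filter] at hk
      exact ⟨(hsg k hk.1).1, hk.2.le⟩)
  have e2 := norm_sum_away_le (s := (s.filter (fun k => ¬ gap X k < m + δ)).filter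
      (fun k => gap X k ≤ m + 1 - δ)) hX0 hκ hδ m
    (fun k hk => hs1 k (Finset.filter_subset _ _ (Finset.filter_subset _ _ hk)))
    (fun k hk => hsκ k (Finset.filter_subset _ _ (Finset.filter_subset _ _ hk)))
    (fun i hi k hk j hij hjk => by
      rw [Finset.mem_filter, Finset.mem_filter, not_lt] at hi hk ⊢
      have := hconv i hi.1.1 k hk.1.1 j hij hjk
      exact ⟨⟨this.1, by linarith⟩, by linarith⟩)
    (fun k hk => by
      rw [Finset.mem_filter, Finset.mem_filter, not_lt] at hk
      exact ⟨hk.1.2, hk.2⟩)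
  have e3 := norm_sum_near_le (s := (s.filter (fun k => ¬ gap X k < m + δ)).filter
      (fun k => ¬ gap X k ≤ m + 1 - δ)) (α := m + 1 - δ) hκ hδ hm0 hrel
    (fun k hk => hs1 k (Finset.filter_subset _ _ (Finset.filter_subset _ _ hk)))
    (fun k hk => hsκ k (Finset.filter_subset _ _ (Finset.filter_subset _ _ hk)))
    (fun i hi k hk j hij hjk => by
      rw [Finset.mem_filter, Finset.mem_filter, not_lt, not_le] at hi hk ⊢
      have := hconv i hi.1.1 k hk.1.1 j hij hjk
      exact ⟨⟨this.1, by linarith⟩, by linarith⟩)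
    (fun k hk => (hsg k (Finset.filter_subset _ _ (Finset.filter_subset _ _ hk))).1)
    (fun k hk => by
      rw [Finset.mem_filter, Finset.mem_filter, not_le] at hk
      exact ⟨hk.2.le, by linarith [(hsg k hk.1.1).2]⟩)
  rw [← Finset.sum_filter_add_sum_filter_not s (fun k => gap X k < m + δ),
    ← Finset.sum_filter_add_sum_filter_not (s.filter (fun k => ¬ gap X k < m + δ))
      (fun k => gap X k ≤ m + 1 - δ)]
  refine (norm_add_le _ _).trans ((add_le_add e1 ((norm_add_le _ _).trans
    (add_le_add e2 e3))).trans_eq ?_)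
  field_simp
  ring

/-! ### Sums of negative powers -/

lemma mul_rpow_succ_le {p t : ℝ} (hp : 0 < p) (ht : 0 < t) :
    p * (t + 1) ^ (-p - 1) ≤ t ^ (-p) - (t + 1) ^ (-p) := by
  have h1 : 0 < t + 1 := by linarith
  have e1 : t ^ (-p) = (t + 1) ^ (-p) * (t / (t + 1)) ^ (-p) := by
    rw [← Real.mul_rpow h1.le (by positivity)]
    congr 1
    field_simp
  have e2 : 1 + p / (t + 1) ≤ (t / (t + 1)) ^ (-p) := by
    rw [Real.rpow_def_of_pos (by positivity)]
    have h2 := Real.log_le_sub_one_of_pos (show 0 < t / (t + 1) by positivity)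
    have h3 : t / (t + 1) - 1 = -(1 / (t + 1)) := by field_simp; ring
    have h4 := Real.add_one_le_exp (Real.log (t / (t + 1)) * -p)
    have h5 : p * (1 / (t + 1)) = p / (t + 1) := by ring
    nlinarith
  rw [e1, Real.rpow_sub_one h1.ne']
  have h6 := mul_le_mul_of_nonneg_left e2 (Real.rpow_nonneg h1.le (-p))
  have h7 : p * ((t + 1) ^ (-p) / (t + 1)) = (t + 1) ^ (-p) * (p / (t + 1)) := by ring
  linarith

lemma sum_rpow_le {p : ℝ} (hp : 0 < p) {h : ℕ} (hh : 1 ≤ h) (M : ℕ) :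
    ∑ m ∈ Finset.Icc h M, (m : ℝ) ^ (-p - 1) ≤ (1 + 1 / p) * (h : ℝ) ^ (-p) := by
  have hh0 : (1 : ℝ) ≤ h := by exact_mod_cast hh
  rcases lt_or_ge M h with hM | hM
  · rw [Finset.Icc_eq_empty (by omega), Finset.sum_empty]
    positivity
  have key : p * ∑ m ∈ Finset.Icc h M, (m : ℝ) ^ (-p - 1)
      ≤ (p + 1) * (h : ℝ) ^ (-p) - (M : ℝ) ^ (-p) := by
    induction M, hM using Nat.le_induction with
    | base =>
      rw [Finset.Icc_self, Finset.sum_singleton]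
      have : (h : ℝ) ^ (-p - 1) ≤ (h : ℝ) ^ (-p) :=
        Real.rpow_le_rpow_of_exponent_le hh0 (by linarith)
      nlinarith
    | succ n hn ih =>
      rw [Finset.sum_Icc_succ_top (by omega), mul_add]
      have hn0 : (0 : ℝ) < n := by exact_mod_cast (show 0 < n by omega)
      have := mul_rpow_succ_le hp hn0
      push_cast
      linarith
  have hM0 : 0 ≤ (M : ℝ) ^ (-p) := by positivity
  have e : (1 + 1 / p) * (h : ℝ) ^ (-p) = (p + 1) * (h : ℝ) ^ (-p) / p := by field_simp
  rw [e, le_div_iff₀ hp]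
  linarith

lemma sum_rpow_neg_half_le (M : ℕ) :
    ∑ m ∈ Finset.Icc 1 M, (m : ℝ) ^ (-(1 / 2) : ℝ) ≤ 2 * √M := by
  induction M with
  | zero => simp
  | succ n ih =>
    rw [Finset.sum_Icc_succ_top (by omega)]
    have hn : (0 : ℝ) < ((n + 1 : ℕ) : ℝ) := by positivity
    rw [Real.rpow_neg hn.le, ← Real.sqrt_eq_rpow]
    have h1 := Real.sqrt_pos.2 hn
    have h2 := Real.sq_sqrt hn.le
    have h3 := Real.sq_sqrt (Nat.cast_nonneg (α := ℝ) n)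
    have h4 : √(n : ℝ) ≤ √((n + 1 : ℕ) : ℝ) := Real.sqrt_le_sqrt (by push_cast; linarith)
    have h5 : (√((n + 1 : ℕ) : ℝ))⁻¹ ≤ 2 * (√((n + 1 : ℕ) : ℝ) - √(n : ℝ)) := by
      rw [inv_le_iff_one_le_mul₀ h1]
      push_cast at *
      nlinarith [sq_nonneg (√((n : ℝ) + 1) - √(n : ℝ))]
    linarith

/-! ### The exponential sum estimate -/

lemma norm_sum_block_le_rpow {X : ℝ} (hX : 0 < X) {m : ℕ} (hm : 1 ≤ m) {a b : ℕ} (ha : 1 ≤ a) :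
    ‖∑ k ∈ (Finset.Icc a b).filter (fun k => ⌊gap X k⌋₊ = m), (k : ℂ) * expCircle (X / k)‖
      ≤ 2 * X ^ (3 / 4 : ℝ) * (m : ℝ) ^ (-(1 / 4) - 1 : ℝ)
        + 2 * X ^ (1 / 2 : ℝ) * (m : ℝ) ^ (-(1 / 2) : ℝ) := by
  have hm0 : (0 : ℝ) < m := by exact_mod_cast hm
  refine (norm_sum_block_le (κ := X ^ (1 / 2 : ℝ) * (m : ℝ) ^ (-(1 / 2) : ℝ))
    (δ := X ^ (-(1 / 4) : ℝ) * (m : ℝ) ^ (3 / 4 : ℝ)) hm (by positivity) (by positivity)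
    ?_ ?_ ha).trans_eq ?_
  · rw [mul_pow, ← Real.rpow_mul_natCast hX.le, ← Real.rpow_mul_natCast hm0.le]
    norm_num
    rw [Real.rpow_neg_one]
    field_simp
  · rw [mul_pow, ← Real.rpow_mul_natCast hX.le, ← Real.rpow_mul_natCast hm0.le, mul_mul_mul_comm,
      ← Real.rpow_add hX, ← Real.rpow_add hm0]
    norm_num
  · have e : X ^ (1 / 2 : ℝ) * (m : ℝ) ^ (-(1 / 2) : ℝ)
        = X ^ (3 / 4 : ℝ) * (m : ℝ) ^ (-(1 / 4) - 1 : ℝ)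
          * (X ^ (-(1 / 4) : ℝ) * (m : ℝ) ^ (3 / 4 : ℝ)) := by
      rw [mul_mul_mul_comm, ← Real.rpow_add hX, ← Real.rpow_add hm0]
      norm_num
    have hd : 0 < X ^ (-(1 / 4) : ℝ) * (m : ℝ) ^ (3 / 4 : ℝ) := by positivity
    rw [mul_add, mul_comm _ (2 : ℝ), ← mul_assoc 2 (X ^ (1 / 2 : ℝ))]
    congr 1
    · rw [e]
      field_simp

/-- The contribution of the middle range `X ^ (1 / 3) ≤ k < N`. -/
lemma norm_sum_middle_le {X : ℝ} (hX : 1 ≤ X) {h N : ℕ} (hh : 1 ≤ h) (hN : (N : ℝ) ^ 2 * h ≤ X) :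
    ‖∑ k ∈ Finset.Icc ⌈X ^ (1 / 3 : ℝ)⌉₊ (N - 1), (k : ℂ) * expCircle (X / k)‖
      ≤ 10 * X ^ (3 / 4 : ℝ) * (h : ℝ) ^ (-(1 / 4) : ℝ) + 4 * X ^ (2 / 3 : ℝ) := by
  have hX0 : 0 < X := by linarith
  set Y := X ^ (1 / 3 : ℝ) with hY
  have hY0 : 0 < Y := by positivity
  have hYX : Y ^ 3 = X := by rw [hY, ← Real.rpow_mul_natCast hX0.le]; norm_num
  have ha : 1 ≤ ⌈Y⌉₊ := Nat.one_le_ceil_iff.2 hY0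
  have hmaps : ∀ k ∈ Finset.Icc ⌈Y⌉₊ (N - 1), ⌊gap X k⌋₊ ∈ Finset.Icc h ⌊Y⌋₊ := by
    intro k hk
    rw [Finset.mem_Icc] at hk
    have hk0 : (0 : ℝ) < k := by exact_mod_cast ha.trans hk.1
    have hkY : Y ≤ k := Nat.ceil_le.1 hk.1
    have hkN : (k : ℝ) + 1 ≤ N := by exact_mod_cast (show k + 1 ≤ N by omega)
    rw [Finset.mem_Icc]
    constructor
    · apply Nat.le_floor
      unfold gap
      rw [le_div_iff₀ (by positivity)]
      refine le_trans ?_ hN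
      have : (k : ℝ) * (k + 1) ≤ N ^ 2 := by nlinarith
      have hh0 : (0 : ℝ) ≤ h := by positivity
      nlinarith
    · apply Nat.floor_le_floor
      unfold gap
      rw [div_le_iff₀ (by positivity), ← hYX]
      have : Y ^ 2 ≤ k * (k + 1) := by nlinarith
      nlinarith
  rw [← Finset.sum_fiberwise_of_maps_to hmaps]
  have hfib : ∀ m ∈ Finset.Icc h ⌊Y⌋₊,
      ‖∑ k ∈ (Finset.Icc ⌈Y⌉₊ (N - 1)).filter (fun k => ⌊gap X k⌋₊ = m),
        (k : ℂ) * expCircle (X / k)‖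
      ≤ 2 * X ^ (3 / 4 : ℝ) * (m : ℝ) ^ (-(1 / 4) - 1 : ℝ)
        + 2 * X ^ (1 / 2 : ℝ) * (m : ℝ) ^ (-(1 / 2) : ℝ) := fun m hm =>
    norm_sum_block_le_rpow hX0 (hh.trans (Finset.mem_Icc.1 hm).1) ha
  refine (norm_sum_le _ _).trans ((Finset.sum_le_sum hfib).trans ?_)
  rw [Finset.sum_add_distrib, ← Finset.mul_sum, ← Finset.mul_sum]
  have h1 := sum_rpow_le (p := 1 / 4) (by norm_num) hh ⌊Y⌋₊
  have h2 : ∑ m ∈ Finset.Icc h ⌊Y⌋₊, (m : ℝ) ^ (-(1 / 2) : ℝ) ≤ 2 * X ^ (1 / 6 : ℝ) := by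
    have e : X ^ (1 / 6 : ℝ) = √Y := by
      rw [Real.sqrt_eq_rpow, hY, ← Real.rpow_mul hX0.le]
      norm_num
    rw [e]
    refine (Finset.sum_le_sum_of_subset_of_nonneg (Finset.Icc_subset_Icc_left hh)
      fun _ _ _ => by positivity).trans ((sum_rpow_neg_half_le _).trans ?_)
    gcongr
    exact Nat.floor_le hY0.le
  have e2 : X ^ (2 / 3 : ℝ) = X ^ (1 / 2 : ℝ) * X ^ (1 / 6 : ℝ) := by
    rw [← Real.rpow_add hX0]; norm_num
  rw [e2]
  have h3 := mul_le_mul_of_nonneg_left h1 (show 0 ≤ 2 * X ^ (3 / 4 : ℝ) by positivity)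
  have h4 := mul_le_mul_of_nonneg_left h2 (show 0 ≤ 2 * X ^ (1 / 2 : ℝ) by positivity)
  norm_num at h3 h4 ⊢
  linarith

lemma norm_natCast_mul_expCircle (k : ℕ) (t : ℝ) : ‖(k : ℂ) * expCircle t‖ = k := by
  rw [norm_mul, norm_expCircle, mul_one, Complex.norm_natCast]

theorem norm_sum_mul_expCircle_le {x : ℝ} (hx : 1 ≤ x) {h : ℕ} (hh : 1 ≤ h) :
    ‖∑ k ∈ Finset.Icc 1 ⌊√x⌋₊, (k : ℂ) * expCircle (h * x / k)‖
      ≤ 16 * x ^ (3 / 4 : ℝ) * (h : ℝ) ^ (1 / 2 : ℝ) := by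
  have hx0 : 0 < x := by linarith
  have hy0 : 0 < √x := Real.sqrt_pos.2 hx0
  have hyx : √x ^ 2 = x := Real.sq_sqrt hx0.le
  have hh1 : (1 : ℝ) ≤ h := by exact_mod_cast hh
  have hh0 : (0 : ℝ) < h := by linarith
  set N := ⌊√x⌋₊ with hN
  have hNy : (N : ℝ) ≤ √x := Nat.floor_le hy0.le
  have hN1 : 1 ≤ N := Nat.le_floor (by simpa using Real.one_le_sqrt.2 hx)
  have hN1' : (1 : ℝ) ≤ N := by exact_mod_cast hN1
  rcases le_total (√x) h with hxh | hxh
  · have h1 : x = x ^ (3 / 4 : ℝ) * √x ^ (1 / 2 : ℝ) := by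
      rw [Real.sqrt_eq_rpow, ← Real.rpow_mul hx0.le, ← Real.rpow_add hx0]
      norm_num
    have h2 : x ≤ x ^ (3 / 4 : ℝ) * (h : ℝ) ^ (1 / 2 : ℝ) := by
      nth_rewrite 1 [h1]
      gcongr
    refine (norm_sum_le _ _).trans ?_
    simp_rw [norm_natCast_mul_expCircle]
    rw [sum_Icc_natCast]
    nlinarith
  · set X := h * x with hXdef
    have hX1 : 1 ≤ X := one_le_mul_of_one_le_of_one_le hh1 hx
    have hX0 : 0 < X := by linarith
    set Y := X ^ (1 / 3 : ℝ) with hY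
    have hY0 : 0 < Y := by positivity
    have hNX : (N : ℝ) ^ 2 * h ≤ X := by
      have : (N : ℝ) ^ 2 ≤ x := by rw [← hyx]; gcongr
      rw [hXdef]; nlinarith
    have hmid := norm_sum_middle_le hX1 hh hNX
    rw [← hY] at hmid
    have hsplit : ‖∑ k ∈ Finset.Icc 1 N, (k : ℂ) * expCircle (X / k)‖
        ≤ Y ^ 2 + N + ‖∑ k ∈ Finset.Icc ⌈Y⌉₊ (N - 1), (k : ℂ) * expCircle (X / k)‖ := by
      have ha : 1 ≤ ⌈Y⌉₊ := Nat.one_le_ceil_iff.2 hY0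
      rw [← Finset.sum_filter_add_sum_filter_not (Finset.Icc 1 N)
        (fun k => ⌈Y⌉₊ ≤ k ∧ k ≤ N - 1)]
      have e1 : (Finset.Icc 1 N).filter (fun k => ⌈Y⌉₊ ≤ k ∧ k ≤ N - 1)
          = Finset.Icc ⌈Y⌉₊ (N - 1) := by
        ext k; simp only [Finset.mem_filter, Finset.mem_Icc]; omega
      have e2 : (Finset.Icc 1 N).filter (fun k => ¬ (⌈Y⌉₊ ≤ k ∧ k ≤ N - 1))
          ⊆ insert N (Finset.Ico 1 ⌈Y⌉₊) := by
        intro k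
        simp only [Finset.mem_filter, Finset.mem_Icc, Finset.mem_insert, Finset.mem_Ico]
        omega
      have e3 : ∑ k ∈ Finset.Ico 1 ⌈Y⌉₊, (k : ℝ) ≤ Y ^ 2 := by
        refine (Finset.sum_le_card_nsmul _ _ Y fun k hk => ?_).trans ?_
        · exact (Nat.lt_ceil.1 (Finset.mem_Ico.1 hk).2).le
        · rw [Nat.card_Ico, nsmul_eq_mul, Nat.cast_sub ha, sq]
          gcongr
          push_cast
          linarith [Nat.ceil_lt_add_one hY0.le]
      have e4 : ‖∑ k ∈ (Finset.Icc 1 N).filter (fun k => ¬ (⌈Y⌉₊ ≤ k ∧ k ≤ N - 1)),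
          (k : ℂ) * expCircle (X / k)‖ ≤ Y ^ 2 + N := by
        refine (norm_sum_le _ _).trans ?_
        simp_rw [norm_natCast_mul_expCircle]
        refine (Finset.sum_le_sum_of_subset_of_nonneg e2 fun _ _ _ => by positivity).trans ?_
        by_cases hmem : N ∈ Finset.Ico 1 ⌈Y⌉₊
        · rw [Finset.insert_eq_of_mem hmem]; linarith
        · rw [Finset.sum_insert hmem]; linarith
      rw [e1]
      refine (norm_add_le _ _).trans ?_
      linarith
    have hY2 : Y ^ 2 = X ^ (2 / 3 : ℝ) := by
      rw [hY, ← Real.rpow_mul_natCast hX0.le]; norm_num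
    have hX23 : X ^ (2 / 3 : ℝ) ≤ x ^ (3 / 4 : ℝ) * (h : ℝ) ^ (1 / 2 : ℝ) := by
      have e1 : (h : ℝ) ^ (2 / 3 : ℝ) = (h : ℝ) ^ (1 / 2 : ℝ) * (h : ℝ) ^ (1 / 6 : ℝ) := by
        rw [← Real.rpow_add hh0]; norm_num
      have e2 : (h : ℝ) ^ (1 / 6 : ℝ) ≤ x ^ (1 / 12 : ℝ) := by
        have e3 : x ^ (1 / 12 : ℝ) = √x ^ (1 / 6 : ℝ) := by
          rw [Real.sqrt_eq_rpow, ← Real.rpow_mul hx0.le]; norm_num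
        rw [e3]
        gcongr
      have e4 : x ^ (3 / 4 : ℝ) = x ^ (2 / 3 : ℝ) * x ^ (1 / 12 : ℝ) := by
        rw [← Real.rpow_add hx0]; norm_num
      rw [hXdef, Real.mul_rpow hh0.le hx0.le, e1, e4]
      have := mul_le_mul_of_nonneg_left e2
        (show 0 ≤ x ^ (2 / 3 : ℝ) * (h : ℝ) ^ (1 / 2 : ℝ) by positivity)
      linarith
    have hX34 : X ^ (3 / 4 : ℝ) * (h : ℝ) ^ (-(1 / 4) : ℝ)
        = x ^ (3 / 4 : ℝ) * (h : ℝ) ^ (1 / 2 : ℝ) := by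
      have : (h : ℝ) ^ (3 / 4 : ℝ) * (h : ℝ) ^ (-(1 / 4) : ℝ) = (h : ℝ) ^ (1 / 2 : ℝ) := by
        rw [← Real.rpow_add hh0]; norm_num
      rw [hXdef, Real.mul_rpow hh0.le hx0.le, ← this]
      ring
    have hN34 : (N : ℝ) ≤ x ^ (3 / 4 : ℝ) * (h : ℝ) ^ (1 / 2 : ℝ) := by
      have e1 : √x ≤ x ^ (3 / 4 : ℝ) := by
        rw [Real.sqrt_eq_rpow]
        exact Real.rpow_le_rpow_of_exponent_le hx (by norm_num)
      have e2 : 1 ≤ (h : ℝ) ^ (1 / 2 : ℝ) := Real.one_le_rpow hh1 (by norm_num)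
      have e3 : 0 ≤ x ^ (3 / 4 : ℝ) := by positivity
      nlinarith
    rw [mul_assoc, hX34] at hmid
    rw [hY2] at hsplit
    linarith

/-! ### The weighted Bernoulli sum -/

lemma hasSum_cos_div_sq (u : ℝ) :
    HasSum (fun h : ℕ => 1 / (h : ℝ) ^ 2 * Real.cos (2 * Real.pi * (h * u)))
      (2 * Real.pi ^ 2 * halfB2 u) := by
  have h := hasSum_one_div_nat_pow_mul_cos (k := 1) one_ne_zero (x := Int.fract u)
    ⟨Int.fract_nonneg u, (Int.fract_lt_one u).le⟩
  have e1 : (-1 : ℝ) ^ (1 + 1) * (2 * Real.pi) ^ (2 * 1) / 2 / (2 * 1).factorial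
      * (Polynomial.map (algebraMap ℚ ℝ) (Polynomial.bernoulli (2 * 1))).eval (Int.fract u)
      = 2 * Real.pi ^ 2 * halfB2 u := by
    simp [Polynomial.bernoulli_def, Finset.sum_range_succ, halfB2, bernoulli_one, bernoulli_two,
      Nat.factorial]
    ring
  rw [e1] at h
  convert! h using 1
  funext n
  have e2 : 2 * Real.pi * (n * u)
      = 2 * Real.pi * n * Int.fract u + (n * ⌊u⌋ : ℤ) * (2 * Real.pi) := by
    rw [Int.fract]
    push_cast
    ring
  rw [e2, Real.cos_add_int_mul_two_pi, mul_one]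

theorem abs_sum_mul_halfB2_le {x : ℝ} (hx : 1 ≤ x) :
    |∑ k ∈ Finset.Icc 1 ⌊√x⌋₊, (k : ℝ) * halfB2 (x / k)| ≤ 8 / 3 * x ^ (3 / 4 : ℝ) := by
  have hx0 : 0 < x := by linarith
  set S := ∑ k ∈ Finset.Icc 1 ⌊√x⌋₊, (k : ℝ) * halfB2 (x / k) with hS
  set c : ℕ → ℝ := fun h => ∑ k ∈ Finset.Icc 1 ⌊√x⌋₊,
    (k : ℝ) * (1 / (h : ℝ) ^ 2 * Real.cos (2 * Real.pi * (h * (x / k)))) with hc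
  have hsum : HasSum c (2 * Real.pi ^ 2 * S) := by
    rw [hS, Finset.mul_sum]
    convert! hasSum_sum fun (k : ℕ) (_ : k ∈ Finset.Icc 1 ⌊√x⌋₊) =>
      (hasSum_cos_div_sq (x / k)).mul_left (k : ℝ) using 1
    exact Finset.sum_congr rfl fun k _ => by ring
  have hterm : ∀ h : ℕ, |c h| ≤ 16 * x ^ (3 / 4 : ℝ) * (h : ℝ) ^ (-(1 / 2) - 1 : ℝ) := by
    intro h
    rcases Nat.eq_zero_or_pos h with rfl | hh
    · simp only [hc]
      rw [Nat.cast_zero, Real.zero_rpow (by norm_num)]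
      simp
    have hh0 : (0 : ℝ) < h := by exact_mod_cast hh
    have h1 := norm_sum_mul_expCircle_le hx hh
    have h2 : c h = 1 / (h : ℝ) ^ 2
        * (∑ k ∈ Finset.Icc 1 ⌊√x⌋₊, (k : ℂ) * expCircle (h * x / k)).re := by
      rw [Complex.re_sum, Finset.mul_sum]
      refine Finset.sum_congr rfl fun k _ => ?_
      rw [← Complex.ofReal_natCast, Complex.re_ofReal_mul, expCircle_re, mul_div_assoc]
      ring
    rw [h2, abs_mul, abs_of_pos (by positivity)]
    calc _ ≤ 1 / (h : ℝ) ^ 2 * (16 * x ^ (3 / 4 : ℝ) * (h : ℝ) ^ (1 / 2 : ℝ)) := by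
          gcongr
          exact (Complex.abs_re_le_norm _).trans h1
      _ = 16 * x ^ (3 / 4 : ℝ) * (h : ℝ) ^ (-(1 / 2) - 1 : ℝ) := by
          have : (h : ℝ) ^ (-(1 / 2) - 1 : ℝ) = (h : ℝ) ^ (1 / 2 : ℝ) / (h : ℝ) ^ 2 := by
            rw [← Real.rpow_natCast, ← Real.rpow_sub hh0]; norm_num
          rw [this]
          ring
  have hpartial : ∀ M : ℕ, |∑ h ∈ Finset.range (M + 1), c h| ≤ 48 * x ^ (3 / 4 : ℝ) := by
    intro M
    have h0 : c 0 = 0 := by simp [hc]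
    rw [Finset.range_eq_Ico, Finset.sum_eq_sum_Ico_succ_bot (by omega), h0, zero_add]
    have e : Finset.Ico (0 + 1) (M + 1) = Finset.Icc 1 M := by
      ext k; simp only [Finset.mem_Ico, Finset.mem_Icc]; omega
    rw [e]
    refine (Finset.abs_sum_le_sum_abs _ _).trans ((Finset.sum_le_sum fun h _ => hterm h).trans ?_)
    rw [← Finset.mul_sum]
    have h1 := sum_rpow_le (p := 1 / 2) (by norm_num) le_rfl M
    rw [Nat.cast_one, Real.one_rpow] at h1
    have h2 := mul_le_mul_of_nonneg_left h1 (show 0 ≤ 16 * x ^ (3 / 4 : ℝ) by positivity)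
    norm_num at h2 ⊢
    linarith
  have hlim : |2 * Real.pi ^ 2 * S| ≤ 48 * x ^ (3 / 4 : ℝ) :=
    le_of_tendsto ((hsum.tendsto_sum_nat.comp (tendsto_add_atTop_nat 1)).abs)
      (Eventually.of_forall hpartial)
  rw [abs_mul, abs_of_pos (by positivity)] at hlim
  have hπ : 9 ≤ Real.pi ^ 2 := by nlinarith [Real.pi_gt_three]
  nlinarith [abs_nonneg S]

lemma log_ge_of_three_hundred_le {x : ℝ} (hx : 300 ≤ x) : 5.5 ≤ Real.log x := by
  have h1 : Real.exp 11 ≤ 90000 := by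
    have h2 : Real.exp 11 = Real.exp 1 ^ 11 := by rw [← Real.exp_nat_mul]; norm_num
    rw [h2]
    calc Real.exp 1 ^ 11 ≤ 2.72 ^ 11 := by
          gcongr
          linarith [Real.exp_one_lt_d9]
      _ ≤ 90000 := by norm_num
  have h3 : (11 : ℝ) ≤ Real.log (x ^ 2) := by
    rw [Real.le_log_iff_exp_le (by positivity)]
    nlinarith
  rw [Real.log_pow] at h3
  push_cast at h3
  linarith

theorem abs_remainder_le_log {x : ℝ} (hx : 300 ≤ x) :
    |remainder x| ≤ Real.log x / x ^ (1 / 4 : ℝ) + 0.236 / √x + 1 / (64 * x) := by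
  have hx1 : 1 ≤ x := by linarith
  have hx0 : 0 < x := by linarith
  have h1 := abs_remainder_le_sum_halfB2 hx1
  have h2 := abs_sum_mul_halfB2_le hx1
  have h3 := log_ge_of_three_hundred_le hx
  have h4 : 2 / x * |∑ k ∈ Finset.Icc 1 ⌊√x⌋₊, (k : ℝ) * halfB2 (x / k)|
      ≤ 16 / 3 / x ^ (1 / 4 : ℝ) := by
    have e : x = x ^ (3 / 4 : ℝ) * x ^ (1 / 4 : ℝ) := by
      rw [← Real.rpow_add hx0]; norm_num
    calc _ ≤ 2 / x * (8 / 3 * x ^ (3 / 4 : ℝ)) := by gcongr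
      _ = 2 / (x ^ (3 / 4 : ℝ) * x ^ (1 / 4 : ℝ)) * (8 / 3 * x ^ (3 / 4 : ℝ)) := by rw [← e]
      _ = 16 / 3 / x ^ (1 / 4 : ℝ) := by field_simp; norm_num
  have h5 : 1 / √x ≤ 1 / x ^ (1 / 4 : ℝ) := by
    rw [Real.sqrt_eq_rpow]
    gcongr
    norm_num
  have h6 : 5.5 / x ^ (1 / 4 : ℝ) ≤ Real.log x / x ^ (1 / 4 : ℝ) := by gcongr
  have e1 : (16 / 3 : ℝ) / x ^ (1 / 4 : ℝ) = 16 / 3 * (1 / x ^ (1 / 4 : ℝ)) := by ring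
  have e2 : (5.5 : ℝ) / x ^ (1 / 4 : ℝ) = 5.5 * (1 / x ^ (1 / 4 : ℝ)) := by ring
  have e3 : (0.248 : ℝ) / √x = 0.248 * (1 / √x) := by ring
  have e4 : (0.236 : ℝ) / √x = 0.236 * (1 / √x) := by ring
  have h7 : 0 < 1 / x ^ (1 / 4 : ℝ) := by positivity
  rw [e1] at h4
  rw [e2] at h6
  rw [e3] at h1
  rw [e4]
  linarith

end DivisorProblem

theorem theorem1 :
    ∃ r : ℝ → ℝ,
      (∀ x : ℝ, 1 ≤ x →
        DivisorProblem.Delta x - x * DivisorProblem.delta x = 1 / 4 + r x) ∧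
      (∀ x : ℝ, 1 ≤ x → |r x| ≤ 1 / 8 + 0.316 / Real.sqrt x + 1 / (64 * x)) ∧
      (∀ x : ℝ, 300 ≤ x →
        |r x| ≤ Real.log x / x ^ (1 / 4 : ℝ) + 0.236 / Real.sqrt x + 1 / (64 * x)) :=
  ⟨DivisorProblem.remainder, fun x _ => by unfold DivisorProblem.remainder; ring,
    fun _ hx => DivisorProblem.abs_remainder_le hx,
    fun _ hx => DivisorProblem.abs_remainder_le_log hx⟩
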